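/- **Setting.** Measurements have outcomes $a=\pm1$ and settings $x\in\{0,1\}$. A measurement system $A$ assigns to each party $k$, acting on a Hilbert space $H_k$, POVMs $\{A^{(k)}_{a|x}\}_a$; its dichotomic operators are $K^{(k)}_x=A^{(k)}_{+1|x}-A^{(k)}_{-1|x}$. A Bell functional $\mathsf B$ is a real linear combination of tensor products of the $K^{(k)}_x$ and identities; $\mathsf B[K]$ is the resulting operator, and $|\mathsf B|\le c$ means $-c\,\mathbb I\le \mathsf B[K]\le c\,\mathbb I$ for all measurement systems on all Hilbert spaces. A (normalized) $q\to1$ connector is a real tensor $\mathsf C^{a_1\dots a_q|x_1\dots x_q}_{b|y}$ whose contraction with $q$ legs of any multipartite quantum behaviour is again a quantum behaviour, and such that $\mathsf C_{b|y}[A]=\sum_{\vec a,\vec x}\mathsf C^{\vec a|\vec x}_{b|y}\bigotimes_k A^{(k)}_{a_k|x_k}$ satisfies $\sum_b \mathsf C_{b|y}[A]=\mathbb I$ for all measurement systems $A$ and all $y$. A connector complex is a triple $(\mathsf C,\bar A,V)$ of such a connector, a measurement system $\bar A$ and a coisometry $V$ ($VV^\dagger=\mathbb I$) for which the operators $\bar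 M_{b|y}=V\mathsf C_{b|y}[\bar A]V^\dagger$ form a projective measurement; then $\mathsf C$ is called tight. Let $\sigma_1=X,\sigma_2=Y,\sigma_3=Z$ be the Pauli matrices. Given Bell functionals $\mathsf B_0,\mathsf B_1$, dichotomic qubit operators $\bar K$, and vectors $\phi,\phi'$, we say that $(\mathsf B_0,\mathsf B_1,\bar K,\phi,\phi')$ *gives a tight connector complex with output operators $S_0,S_1$* if $|\mathsf B_0|\le1$ and $|\mathsf B_1|\le 1$, and there is a connector with $\mathsf C_{\pm|y}[A]=\frac{\mathbb I\pm\mathsf B_y[K]}2$ for all $A$ which, together with $\bar A^{(k)}_{\pm|x}=\frac{\mathbb I\pm\bar K^{(k)}_x}{2}$ and $V=|0\rangle\langle\phi|+|1\rangle\langle\phi'|$, is a connector complex with $\bar M_{\pm|y}=\frac{\mathbb I\pm S_y}{2}$. **Theorem.** 1. *CHSH–Tsirelson.* Let $2\sqrt2\,\mathsf B_0[K]=-K^{(1)}_0\otimes K^{(2)}_0+K^{(1)}_1\otimes K^{(2)}_0+K^{(1)}_0\otimes K^{(2)}_1+K^{(1)}_1\otimes K^{(2)}_1$, $2\sqrt2\,\mathsf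 B_1[K]=K^{(1)}_0\otimes K^{(2)}_0+K^{(1)}_1\otimes K^{(2)}_0+K^{(1)}_0\otimes K^{(2)}_1-K^{(1)}_1\otimes K^{(2)}_1$, $\bar K^{(1)}_0=\sigma_3$, $\bar K^{(1)}_1=\sigma_1$, $\bar K^{(2)}_0=\frac{\sigma_3+\sigma_1}{\sqrt2}$, $\bar K^{(2)}_1=\frac{\sigma_3-\sigma_1}{\sqrt2}$, $|\phi_+\rangle=\frac{|00\rangle+|11\rangle}{\sqrt2}$, $|\phi_-\rangle=\frac{|10\rangle-|01\rangle}{\sqrt2}$. Then $\mathsf B_1[\bar K]|\phi_\pm\rangle=\pm|\phi_\pm\rangle$ and $\mathsf B_0[\bar K]|\phi_\pm\rangle=|\phi_\mp\rangle$, and $(\mathsf B_0,\mathsf B_1,\bar K,\phi_+,\phi_-)$ gives a tight connector complex with output operators $\sigma_1,\sigma_3$. 2. *Tilted CHSH.* Let $\theta\in\mathbb R$, $\alpha=2\,\mathrm{sgn}(\cos2\theta)\,(1+2\tan^2 2\theta)^{-1/2}$ (with $\alpha=0$ if $\cos 2\theta=0$), $\beta=\sqrt{8+2\alpha^2}$,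 $\mu=\arctan(\sin2\theta)$. Let $\beta\,\mathsf B_0$ and $\beta\,\mathsf B_1$ be the right-hand sides of the two formulas in 1 plus $\alpha K^{(1)}_1\otimes\mathbb I$ and $\alpha K^{(1)}_0\otimes\mathbb I$, respectively; let $\bar K^{(1)}_0=\sigma_3$, $\bar K^{(1)}_1=\sigma_1$, $\bar K^{(2)}_0=\cos\mu\,\sigma_3+\sin\mu\,\sigma_1$, $\bar K^{(2)}_1=\cos\mu\,\sigma_3-\sin\mu\,\sigma_1$, $|\phi_+\rangle=\cos\theta|00\rangle+\sin\theta|11\rangle$, $|\phi_-\rangle=\cos\theta|10\rangle-\sin\theta|01\rangle$. Then $\mathsf B_1[\bar K]|\phi_\pm\rangle=\pm|\phi_\pm\rangle$ and $\mathsf B_0[\bar K]|\phi_\pm\rangle=|\phi_\mp\rangle$, and $(\mathsf B_0,\mathsf B_1,\bar K,\phi_+,\phi_-)$ gives a tight connector complex with output operators $\sigma_1,\sigma_3$. 3. *WBC.* Let $\theta,\varphi,\omega\in\mathbb R$ with $\cos(\theta+\varphi)\cos(\varphi)\cos(\theta+\omega)\cos(\omega)<0$, let $\beta=\sin\theta\,\sin(\omega-\varphi)\,\sin(\theta+\varphi+\omega)$,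 $\beta\,\mathsf B_1[K]=\cos(\theta+\varphi)\cos(\theta+\omega)\big(\cos\omega\,K^{(1)}_0\otimes K^{(2)}_0-\cos\varphi\,K^{(1)}_0\otimes K^{(2)}_1\big)+\cos\varphi\cos\omega\big(\cos(\theta+\varphi)\,K^{(1)}_1\otimes K^{(2)}_1-\cos(\theta+\omega)\,K^{(1)}_1\otimes K^{(2)}_0\big)$, and let $\mathsf B_0$ be $\mathsf B_1$ with settings $0$ and $1$ exchanged for both parties. Let $\bar K^{(1)}_0=\sigma_1$, $\bar K^{(1)}_1=\cos\theta\,\sigma_1+\sin\theta\,\sigma_2$, $\bar K^{(2)}_0=\cos\varphi\,\sigma_1+\sin\varphi\,\sigma_2$, $\bar K^{(2)}_1=\cos\omega\,\sigma_1+\sin\omega\,\sigma_2$, $|\phi_\pm\rangle=\frac{|00\rangle\pm i|11\rangle}{\sqrt2}$, and $\delta=\theta+\varphi+\omega$. Then $\mathsf B_1[\bar K]|\phi_\pm\rangle=\pm|\phi_\pm\rangle$, $\mathsf B_0[\bar K]|\phi_+\rangle=-\cos\delta|\phi_+\rangle+i\sin\delta|\phi_-\rangle$, $\mathsf B_0[\bar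 K]|\phi_-\rangle=\cos\delta|\phi_-\rangle-i\sin\delta|\phi_+\rangle$, and $(\mathsf B_0,\mathsf B_1,\bar K,\phi_+,-\phi_-)$ gives a tight connector complex with output operators $-\cos\delta\,\sigma_3-\sin\delta\,\sigma_2$ and $\sigma_3$. 4. *BASTA.* Let $\mathcal G$ be a finite simple graph on $q$ vertices, $v_1$ a vertex with $n_1$ neighbours, and $n(i)$ the set of neighbours of $i$. Let $\mathsf B[K]=n_1(K^{(1)}_0+K^{(1)}_1)\bigotimes_{i\in n(1)}K^{(i)}_1+\sum_{i\in n(1)}(K^{(1)}_0-K^{(1)}_1)\otimes K^{(i)}_0\bigotimes_{1\ne j\in n(i)}K^{(j)}_1+\sum_{j\notin n(1)\cup\{1\}}K^{(j)}_0\bigotimes_{k\in n(j)}K^{(k)}_1$, $\mathsf B'[K]=n_1(K^{(1)}_0-K^{(1)}_1)\bigotimes_{i>1}K^{(i)}_1-\sum_{i\in n(1)}(K^{(1)}_0+K^{(1)}_1)\otimes K^{(i)}_0\bigotimes_{j\in\mathsf{EN}_i}K^{(j)}_1$, where $\mathsf{EN}_i$ is the set of vertices adjacent to both $v_1$ and $v_i$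 or to neither. Let $\bar K^{(1)}_0=\frac{X+Z}{\sqrt2}$, $\bar K^{(1)}_1=\frac{X-Z}{\sqrt2}$, and $\bar K^{(j)}_0=X$, $\bar K^{(j)}_1=Z$ for $j\neq1$. Let $|\phi_+\rangle=2^{-q/2}\sum_{\vec x}(-1)^{\sum_{ij\in\mathcal E}x_ix_j}|\vec x\rangle$ and $|\phi_-\rangle=\bigotimes_iZ_i|\phi_+\rangle$ be the graph and antigraph states; put $\beta_1=(2\sqrt2-1)n_1+q-1$ and $\beta_0=2\sqrt2\,n_1$. Then $X_j\bigotimes_{k\in n(j)}Z_k|\phi_\pm\rangle=\pm|\phi_\pm\rangle$ for every vertex $j$; $|\mathsf B|\le\beta_1$ and $\mathsf B[\bar K]|\phi_\pm\rangle=\pm\beta_1|\phi_\pm\rangle$; $|\mathsf B'|\le2\sqrt2\,n_1$ and $\mathsf B'[\bar K]|\phi_\pm\rangle=2\sqrt2\,n_1|\phi_\mp\rangle$. If $n_1\ge1$, then $\mathsf B_1=\mathsf B/\beta_1$ and $\mathsf B_0=\mathsf B'/\beta_0$ satisfy $\mathsf B_1[\bar K]|\phi_\pm\rangle=\pm|\phi_\pm\rangle$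 and $\mathsf B_0[\bar K]|\phi_\pm\rangle=|\phi_\mp\rangle$, and $(\mathsf B_0,\mathsf B_1,\bar K,\phi_+,\phi_-)$ gives a tight connector complex with output operators $\sigma_1,\sigma_3$. -/

import Mathlib

open scoped ENNReal

universe u

noncomputable section

/-! ### Hilbert spaces, kets and tensor products of operators

Every Hilbert space is `ℓ²(ι)` for some index set `ι`, up to unitary equivalence, and the Hilbert
space tensor product of the spaces `ℓ²(ι v)` is `ℓ²(∏ v, ι v)`. -/

/-- The complex Hilbert space `ℓ²(ι)`. For `ι = Fin 2` it is a qubit. -/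
abbrev Hil (ι : Type*) : Type _ := lp (fun _ : ι => ℂ) 2

/-- Bounded operators on `ℓ²(ι)`. -/
abbrev Op (ι : Type*) := Hil ι →L[ℂ] Hil ι

open Classical in
/-- The standard basis vector `|i⟩`. -/
def ket {ι : Type*} (i : ι) : Hil ι := lp.single 2 i (1 : ℂ)

theorem ket_apply {ι : Type*} [DecidableEq ι] (i j : ι) :
    (ket i) j = if j = i then (1 : ℂ) else 0 := by
  by_cases h : j = i
  · subst h
    rw [if_pos rfl]
    exact @lp.single_apply_self ι (fun _ => ℂ) _ (_) 2 j 1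
  · rw [if_neg h]
    exact @lp.single_apply_ne ι (fun _ => ℂ) _ (_) 2 i 1 _ h

theorem enorm_sq_eq_ofReal {E : Type*} [NormedAddCommGroup E] (x : E) :
    ‖x‖ₑ ^ 2 = ENNReal.ofReal (‖x‖ ^ 2) := by
  rw [← ofReal_norm, ENNReal.ofReal_pow (norm_nonneg _)]

theorem enorm_sq_hil {ι : Type*} (f : Hil ι) : ∑' i, ‖f i‖ₑ ^ 2 = ‖f‖ₑ ^ 2 := by
  have h := lp.hasSum_norm (p := 2) (by norm_num) f
  have h' : HasSum (fun i => ‖f i‖ ^ 2) (‖f‖ ^ 2) := by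
    simpa using h
  refine (tsum_congr fun i => enorm_sq_eq_ofReal (f i)).trans ?_
  refine Eq.trans ?_ (enorm_sq_eq_ofReal f).symm
  rw [← h'.tsum_eq, ENNReal.ofReal_tsum_of_nonneg (fun _ => by positivity) h'.summable]

theorem memHil_of_enorm {ι : Type*} {f : ι → ℂ} (h : ∑' i, ‖f i‖ₑ ^ 2 ≠ ⊤) :
    Memℓp f 2 := by
  apply memℓp_gen
  have h2 := ENNReal.summable_toReal h
  refine h2.congr fun i => ?_
  simp [ENNReal.toReal_pow]

section Leg

variable {V : Type*} [DecidableEq V] {ι : V → Type*}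

/-- The restriction of `f ∈ ℓ²(∏ v, ι v)` to the line through `i` in direction `k`. -/
def lineRestrict (k : V) (i : ∀ v, ι v) (f : Hil (∀ v, ι v)) : Hil (ι k) :=
  ⟨fun t => f (Function.update i k t), by
    apply memℓp_gen
    exact ((lp.memℓp f).summable (by norm_num)).comp_injective (Function.update_injective i k)⟩

theorem lineRestrict_apply (k : V) (i : ∀ v, ι v) (f : Hil (∀ v, ι v)) (t : ι k) :
    lineRestrict k i f t = f (Function.update i k t) := rfl

theorem leg_bound (k : V) (A : Op (ι k)) (f : Hil (∀ v, ι v)) :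
    ∑' i : ∀ v, ι v, ‖(A (lineRestrict k i f)) (i k)‖ₑ ^ 2 ≤ ‖A‖ₑ ^ 2 * ‖f‖ₑ ^ 2 := by
  classical
  let e := (Equiv.piSplitAt k ι).symm
  have hk : ∀ t r, e (t, r) k = t := fun t r => by simp [e]
  have hu : ∀ t r s, Function.update (e (t, r)) k s = e (s, r) := by
    intro t r s
    funext v
    by_cases hv : v = k
    · subst hv; simp [e]
    · simp [e, hv]
  have split : ∀ g : (∀ v, ι v) → ℝ≥0∞, ∑' i, g i = ∑' r, ∑' t, g (e (t, r)) := by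
    intro g
    rw [← e.tsum_eq, ENNReal.tsum_prod', ENNReal.tsum_comm]
  rw [split, ← enorm_sq_hil f, split, ← ENNReal.tsum_mul_left]
  refine ENNReal.tsum_le_tsum fun r => ?_
  rcases isEmpty_or_nonempty (ι k) with hE | ⟨⟨t₀⟩⟩
  · simp
  have hl : ∀ t, lineRestrict k (e (t, r)) f = lineRestrict k (e (t₀, r)) f := by
    intro t
    ext s
    simp only [lineRestrict_apply, hu]
  have h1 : ∑' t, ‖(A (lineRestrict k (e (t, r)) f)) (e (t, r) k)‖ₑ ^ 2
      = ‖A (lineRestrict k (e (t₀, r)) f)‖ₑ ^ 2 := by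
    rw [← enorm_sq_hil]
    refine tsum_congr fun t => ?_
    rw [hl, hk]
  have h2 : ∑' t, ‖f (e (t, r))‖ₑ ^ 2 = ‖lineRestrict k (e (t₀, r)) f‖ₑ ^ 2 := by
    rw [← enorm_sq_hil]
    refine tsum_congr fun t => ?_
    rw [lineRestrict_apply, hu]
  rw [h1, h2, ← mul_pow]
  gcongr
  exact ContinuousLinearMap.le_opENorm A _

/-- The operator `A` acting on the tensor factor `k` of `ℓ²(∏ v, ι v)`. -/
def leg (k : V) (A : Op (ι k)) : Op (∀ v, ι v) :=
  LinearMap.mkContinuous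
    { toFun := fun f => (⟨fun i => (A (lineRestrict k i f)) (i k),
        memHil_of_enorm (ne_top_of_le_ne_top (by finiteness) (leg_bound k A f))⟩ :
          Hil (∀ v, ι v))
      map_add' := by
        intro f g
        ext i
        have : lineRestrict k i (f + g) = lineRestrict k i f + lineRestrict k i g := by
          ext t; rfl
        change (A (lineRestrict k i (f + g))) (i k) = _
        rw [this, map_add]
        rfl
      map_smul' := by
        intro c f
        ext i
        have : lineRestrict k i (c • f) = c • lineRestrict k i f := by
          ext t; rfl
        change (A (lineRestrict k i (c • f))) (i k) = _
        rw [this, map_smul]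
        rfl }
    ‖A‖ (by
      intro f
      have h := leg_bound k A f
      rw [← mul_pow] at h
      set g : Hil (∀ v, ι v) := ⟨fun i => (A (lineRestrict k i f)) (i k),
        memHil_of_enorm (ne_top_of_le_ne_top (by finiteness) (leg_bound k A f))⟩
      have h' : ‖g‖ₑ ^ 2 ≤ (‖A‖ₑ * ‖f‖ₑ) ^ 2 := by
        rw [← enorm_sq_hil]; exact h
      have h'' : ‖g‖ₑ ≤ ‖A‖ₑ * ‖f‖ₑ := (ENNReal.pow_le_pow_left_iff (by norm_num)).1 h'
      have := ENNReal.toReal_mono (by finiteness) h''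
      simpa [ENNReal.toReal_mul] using this)

theorem leg_apply (k : V) (A : Op (ι k)) (f : Hil (∀ v, ι v)) (i : ∀ v, ι v) :
    (leg k A f) i = (A (lineRestrict k i f)) (i k) := rfl

end Leg

theorem exists_tensorOp {V : Type*} [Fintype V] {ι : V → Type*} (A : ∀ v, Op (ι v)) :
    ∃ T : Op (∀ v, ι v), ∀ i j : ∀ v, ι v,
      (T (ket j)) i = ∏ v, (A v (ket (j v))) (i v) := by
  classical
  suffices h : ∀ s : Finset V, ∃ T : Op (∀ v, ι v), ∀ i j : ∀ v, ι v,
      (T (ket j)) i = ∏ v, if v ∈ s then (A v (ket (j v))) (i v) else ket (j v) (i v) by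
    obtain ⟨T, hT⟩ := h Finset.univ
    exact ⟨T, fun i j => by simpa using hT i j⟩
  intro s
  induction s using Finset.induction_on with
  | empty =>
    refine ⟨1, fun i j => ?_⟩
    simp only [Finset.notMem_empty, if_false, ket_apply, one_apply_eq_self]
    by_cases hij : i = j
    · simp [hij]
    · obtain ⟨v, hv⟩ := Function.ne_iff.1 hij
      rw [if_neg hij, Finset.prod_eq_zero (Finset.mem_univ v) (by simp [hv])]
  | insert k s hk ih =>
    obtain ⟨T, hT⟩ := ih
    refine ⟨leg k (A k) * T, fun i j => ?_⟩
    set c : ℂ := ∏ v ∈ Finset.univ.erase k,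
      if v ∈ s then (A v (ket (j v))) (i v) else ket (j v) (i v) with hc
    have hl : lineRestrict k i (T (ket j)) = c • ket (j k) := by
      ext t
      rw [lineRestrict_apply, hT, ← Finset.mul_prod_erase _ _ (Finset.mem_univ k)]
      simp only [hk, if_false, Function.update_self]
      rw [mul_comm]
      change _ = c * (ket (j k)) t
      congr 1
      refine Finset.prod_congr rfl fun v hv => ?_
      rw [Function.update_of_ne (Finset.ne_of_mem_erase hv)]
    rw [mul_apply_eq_comp, leg_apply, hl, map_smul,
      ← Finset.mul_prod_erase _ _ (Finset.mem_univ k)]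
    simp only [Finset.mem_insert_self, if_true]
    change c * _ = _
    rw [mul_comm]
    congr 1
    refine Finset.prod_congr rfl fun v hv => ?_
    simp [Finset.ne_of_mem_erase hv]

/-- The tensor product `⨂ v, A v`: the bounded operator on `ℓ²(∏ v, ι v)` whose matrix elements in
the standard basis are `⟨i| ⨂ A |j⟩ = ∏ v, ⟨i v| A v |j v⟩`. -/
def tensorOp {V : Type*} [Fintype V] {ι : V → Type*} (A : ∀ v, Op (ι v)) : Op (∀ v, ι v) :=
  (exists_tensorOp A).choose

theorem tensorOp_ket {V : Type*} [Fintype V] {ι : V → Type*} (A : ∀ v, Op (ι v))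
    (i j : ∀ v, ι v) : (tensorOp A (ket j)) i = ∏ v, (A v (ket (j v))) (i v) :=
  (exists_tensorOp A).choose_spec i j

/-- A bounded operator is determined by its values on the standard basis. -/
theorem op_ext_ket {ι κ : Type*} {S T : Hil ι →L[ℂ] Hil κ} (h : ∀ j, S (ket j) = T (ket j)) :
    S = T := by
  classical
  ext1 f
  have hf : HasSum (fun i => f i • ket i) f := by
    have h1 := lp.hasSum_single (p := 2) (by norm_num) f
    have h2 : (fun i => f i • ket i) = fun i => lp.single 2 i (f i) := by
      funext i
      have := lp.single_smul (E := fun _ : ι => ℂ) 2 i (f i) (1 : ℂ)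
      simp only [smul_eq_mul, mul_one] at this
      rw [this, ket]
    rw [h2]
    exact h1
  rw [← (S.hasSum hf).tsum_eq, ← (T.hasSum hf).tsum_eq]
  simp [h]

/-! ### Measurements, quantum behaviours and connectors -/

/-- `A a x` is the POVM element of outcome `a` in setting `x`. -/
def IsMeasurement {O X : Type*} [Fintype O] {ι : Type*} (A : O → X → Op ι) : Prop :=
  (∀ a x, (A a x).IsPositive) ∧ ∀ x, ∑ a, A a x = 1

/-- Each setting is a complete family of orthogonal projectors. -/
def IsProjectiveMeasurement {O X : Type*} [Fintype O] {ι : Type*} (M : O → X → Op ι) : Prop :=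
  (∀ a x, IsStarProjection (M a x)) ∧ ∀ x, ∑ a, M a x = 1

/-- Operators for two groups of parties, as one family. -/
def joinOps {V W : Type*} {ι : V → Type u} {κ : W → Type u}
    (A : ∀ v, Op (ι v)) (D : ∀ w, Op (κ w)) : ∀ s : V ⊕ W, Op (Sum.elim ι κ s)
  | Sum.inl v => A v
  | Sum.inr w => D w

/-- `P(a, c | x, z)` is a quantum behaviour of the parties `V ⊕ W`, where the parties in `V` have
outcomes `a` and settings `x` and the parties in `W` have outcomes `c` and settings `z`:
`P(a, c | x, z) = Tr ((⨂ A_{a|x} ⊗ ⨂ D_{c|z}) ρ)` for some measurements and some density operator,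
written as `ρ = ∑ n, |ψ n⟩⟨ψ n|` with `∑ n, ‖ψ n‖² = 1`. -/
def IsQuantumBehaviour {V W : Type} [Fintype V] [Fintype W] {O X O' X' : Type}
    [Fintype O] [Fintype O'] (P : (V → O) → (V → X) → (W → O') → (W → X') → ℝ) : Prop :=
  ∃ (ι : V → Type u) (κ : W → Type u)
    (A : ∀ v, O → X → Op (ι v)) (D : ∀ w, O' → X' → Op (κ w))
    (ψ : ℕ → Hil (∀ s : V ⊕ W, Sum.elim ι κ s)),
    (∀ v, IsMeasurement (A v)) ∧ (∀ w, IsMeasurement (D w)) ∧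
    HasSum (fun n => ‖ψ n‖ ^ 2) 1 ∧
    ∀ a x c z, HasSum
      (fun n => inner ℂ (ψ n) (tensorOp
        (joinOps (fun v => A v (a v) (x v)) (fun w => D w (c w) (z w))) (ψ n)))
      (P a x c z : ℂ)

/-- The tensor `C_{b|y}^{a|x}` of a `V → 1` connector: `b`, `y` are the outcome and the setting of
the output leg, `a`, `x` those of the input legs. -/
abbrev ConnectorTensor (V O X B Y : Type) := B → Y → (V → O) → (V → X) → ℝ

/-- `C_{b|y}[A] = ∑_{a,x} C_{b|y}^{a|x} ⨂ v, A v_{a v|x v}`. -/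
def ConnectorTensor.apply {V O X B Y : Type} [Fintype V] [DecidableEq V] [Fintype O] [Fintype X]
    (C : ConnectorTensor V O X B Y) {ι : V → Type*} (A : ∀ v, O → X → Op (ι v)) (b : B) (y : Y) :
    Op (∀ v, ι v) :=
  ∑ a : V → O, ∑ x : V → X, (C b y a x : ℂ) • tensorOp (fun v => A v (a v) (x v))

/-- `C` is a normalized connector: contracting the legs `V` of any quantum behaviour, shared
with any finite set `W` of further parties, gives a quantum behaviour of the output leg and
the parties `W`, and `∑_b C_{b|y}[A] = 1` for all measurement systems `A`. -/
def ConnectorTensor.IsConnector {V O X B Y : Type} [Fintype V] [DecidableEq V] [Fintype O]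
    [Fintype X] [Fintype B] (C : ConnectorTensor V O X B Y) : Prop :=
  (∀ (W O' X' : Type) [Fintype W] [Fintype O']
    (P : (V → O) → (V → X) → (W → O') → (W → X') → ℝ),
    IsQuantumBehaviour.{u} P →
    IsQuantumBehaviour.{u} (fun (b : Unit → B) (y : Unit → Y) c z =>
      ∑ a : V → O, ∑ x : V → X, C (b ()) (y ()) a x * P a x c z)) ∧
  ∀ (ι : V → Type u) (A : ∀ v, O → X → Op (ι v)), (∀ v, IsMeasurement (A v)) →
    ∀ y, ∑ b, C.apply A b y = 1

/-- The renormalized operators `M_{b|y} = T C_{b|y}[A] T†`. -/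
def ConnectorTensor.renormalized {V O X B Y : Type} [Fintype V] [DecidableEq V] [Fintype O]
    [Fintype X] (C : ConnectorTensor V O X B Y) {ι : V → Type*} {κ : Type*}
    (A : ∀ v, O → X → Op (ι v)) (T : Hil (∀ v, ι v) →L[ℂ] Hil κ) (b : B) (y : Y) : Op κ :=
  T ∘L C.apply A b y ∘L T.adjoint

/-- `(C, A, T)` is a connector complex: `C` is a connector, `A` a measurement system, `T` a
coisometry, and the operators `T C_{b|y}[A] T†` form a projective measurement. In particular
`C` is tight. -/
structure IsConnectorComplex {V O X B Y : Type} [Fintype V] [DecidableEq V] [Fintype O]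
    [Fintype X] [Fintype B] (C : ConnectorTensor V O X B Y) {ι : V → Type*} {κ : Type*}
    (A : ∀ v, O → X → Op (ι v)) (T : Hil (∀ v, ι v) →L[ℂ] Hil κ) : Prop where
  isConnector : ConnectorTensor.IsConnector.{u} C
  isMeasurement : ∀ v, IsMeasurement (A v)
  coisometry : T ∘L T.adjoint = 1
  projective : IsProjectiveMeasurement (C.renormalized A T)

/-! ### Bell functionals with outcomes `±1` and settings `0, 1` -/

/-- The dichotomic operators `K_x = A_{+1|x} - A_{-1|x}`. -/
def correlator {ι : Type*} (A : ℤˣ → Fin 2 → Op ι) (x : Fin 2) : Op ι := A 1 x - A (-1) x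

/-- The measurement `A_{b|x} = (1 + b K_x) / 2` with dichotomic operators `K_x`. -/
def dichotomic {ι : Type*} (K : Fin 2 → Op ι) (b : ℤˣ) (x : Fin 2) : Op ι :=
  (1 / 2 : ℂ) • (1 + ((b : ℤ) : ℂ) • K x)

/-- A Bell functional in the correlator basis: `B s` is the coefficient of `⨂ v, K^{(v)}_{s v}`,
where `K^{(v)}_x` is the dichotomic operator of party `v` in setting `x`, encoded as `some x`, and
`none` stands for the identity operator. -/
abbrev BellFunctional (V : Type) := (V → Option (Fin 2)) → ℝ

section Bell

variable {V : Type} [Fintype V] [DecidableEq V]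

/-- The Bell operator `B[K]`. -/
def BellFunctional.op (B : BellFunctional V) {ι : V → Type*} (K : ∀ v, Fin 2 → Op (ι v)) :
    Op (∀ v, ι v) :=
  ∑ s : V → Option (Fin 2), (B s : ℂ) • tensorOp (fun v => (s v).elim 1 (K v))

/-- `-c ≤ B[K] ≤ c` for all measurement systems on all Hilbert spaces. -/
def BellFunctional.BoundedBy (c : ℝ) (B : BellFunctional V) : Prop :=
  ∀ (ι : V → Type u) (A : ∀ v, ℤˣ → Fin 2 → Op (ι v)), (∀ v, IsMeasurement (A v)) →
    ((c : ℂ) • 1 - B.op (fun v => correlator (A v))).IsPositive ∧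
    ((c : ℂ) • 1 + B.op (fun v => correlator (A v))).IsPositive

/-- The functional `⨂ v, K^{(v)}_{s v}`. -/
def mono (s : V → Option (Fin 2)) : BellFunctional V := Pi.single s 1

/-- The coefficients `B^{a|x}` of a Bell functional in terms of the POVM elements: `K_x` is
`∑_a a A_{a|x}` and the identity is written as `∑_a A_{a|0}`. -/
def BellFunctional.toTensor (B : BellFunctional V) (a : V → ℤˣ) (x : V → Fin 2) : ℝ :=
  ∑ s : V → Option (Fin 2), B s * ∏ v, (s v).elim (if x v = 0 then 1 else 0)
    (fun t => if x v = t then (((a v : ℤˣ) : ℤ) : ℝ) else 0)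

/-- The tensor of `C_{b|y} = (1 + b B_y) / 2`. -/
def connectorOf (B : Fin 2 → BellFunctional V) : ConnectorTensor V ℤˣ (Fin 2) ℤˣ (Fin 2) :=
  fun b y => BellFunctional.toTensor
    ((1 / 2 : ℝ) • (mono (fun _ => none) + ((b : ℤ) : ℝ) • B y))

/-- `|0⟩⟨φ| + |1⟩⟨φ'|`. -/
def coisometryOf {κ : Type*} (φ φ' : Hil κ) : Hil κ →L[ℂ] Hil (Fin 2) :=
  (innerSL ℂ φ).smulRight (ket 0) + (innerSL ℂ φ').smulRight (ket 1)

/-- The functionals `B 0`, `B 1` are normalized, `C_{b|y} = (1 + b B_y) / 2` defines a connector,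
and, with the qubit measurements with dichotomic operators `K` and the coisometry
`T = |0⟩⟨φ| + |1⟩⟨φ'|`, this is a connector complex with
`T C_{b|y}[A] T† = (1 + b S_y) / 2`. -/
structure GivesComplex (B : Fin 2 → BellFunctional V) (K : V → Fin 2 → Op (Fin 2))
    (φ φ' : Hil (V → Fin 2)) (S : Fin 2 → Op (Fin 2)) : Prop where
  normalized : ∀ y, BellFunctional.BoundedBy.{u} 1 (B y)
  connector_apply : ∀ (ι : V → Type u) (A : ∀ v, ℤˣ → Fin 2 → Op (ι v)),
    (∀ v, IsMeasurement (A v)) → ∀ b y, (connectorOf B).apply A b y =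
      (1 / 2 : ℂ) • (1 + ((b : ℤ) : ℂ) • (B y).op (fun v => correlator (A v)))
  isComplex : IsConnectorComplex.{u} (connectorOf B) (fun v => dichotomic (K v))
    (coisometryOf φ φ')
  renormalized_eq : ∀ b y, (connectorOf B).renormalized (fun v => dichotomic (K v))
    (coisometryOf φ φ') b y = (1 / 2 : ℂ) • (1 + ((b : ℤ) : ℂ) • S y)

end Bell

/-- The operator on `ℂⁿ` with matrix `M` in the standard basis. -/
def matOp {n : Type*} [Fintype n] [DecidableEq n] (M : Matrix n n ℂ) : Op n :=
  (lpPiLpₗᵢ (fun _ : n => ℂ) ℂ (p := 2)).symm.toContinuousLinearEquiv.toContinuousLinearMap ∘L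
    Matrix.toEuclideanCLM (n := n) (𝕜 := ℂ) M ∘L
    (lpPiLpₗᵢ (fun _ : n => ℂ) ℂ (p := 2)).toContinuousLinearEquiv.toContinuousLinearMap

/-- The Pauli operator `σ₁ = X`. -/
def σX : Op (Fin 2) := matOp !![0, 1; 1, 0]

/-- The Pauli operator `σ₂ = Y`. -/
def σY : Op (Fin 2) := matOp !![0, -Complex.I; Complex.I, 0]

/-- The Pauli operator `σ₃ = Z`. -/
def σZ : Op (Fin 2) := matOp !![1, 0; 0, -1]

/-! ### Two-party functionals -/

/-- `K^{(1)}_x ⊗ K^{(2)}_y`. -/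
def cor (x y : Fin 2) : BellFunctional (Fin 2) := mono ![some x, some y]

/-- `K^{(1)}_x ⊗ 1`. -/
def corFst (x : Fin 2) : BellFunctional (Fin 2) := mono ![some x, none]

namespace CHSH

/-- The functionals `B₀`, `B₁`. -/
def B : Fin 2 → BellFunctional (Fin 2) :=
  ![(1 / (2 * √2)) • (-cor 0 0 + cor 1 0 + cor 0 1 + cor 1 1),
    (1 / (2 * √2)) • (cor 0 0 + cor 1 0 + cor 0 1 - cor 1 1)]

def K : Fin 2 → Fin 2 → Op (Fin 2) :=
  ![![σZ, σX],
    ![((1 / √2 : ℝ) : ℂ) • (σZ + σX), ((1 / √2 : ℝ) : ℂ) • (σZ - σX)]]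

def φp : Hil (Fin 2 → Fin 2) := ((1 / √2 : ℝ) : ℂ) • (ket ![0, 0] + ket ![1, 1])

def φm : Hil (Fin 2 → Fin 2) := ((1 / √2 : ℝ) : ℂ) • (ket ![1, 0] - ket ![0, 1])

end CHSH

namespace Tilted

/-- `α(θ) = ± 2 (1 + 2 tan² 2θ)^(-1/2)` with the sign of `cos 2θ`, and `α(θ) = 0` where
`cos 2θ = 0` (the limit value). -/
def α (θ : ℝ) : ℝ := 2 * Real.sign (Real.cos (2 * θ)) / √(1 + 2 * Real.tan (2 * θ) ^ 2)

def β (θ : ℝ) : ℝ := √(8 + 2 * α θ ^ 2)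

def μ (θ : ℝ) : ℝ := Real.arctan (Real.sin (2 * θ))

/-- The functionals `B₀`, `B₁`. -/
def B (θ : ℝ) : Fin 2 → BellFunctional (Fin 2) :=
  ![(1 / β θ) • (α θ • corFst 1 - cor 0 0 + cor 1 0 + cor 0 1 + cor 1 1),
    (1 / β θ) • (α θ • corFst 0 + cor 0 0 + cor 1 0 + cor 0 1 - cor 1 1)]

def K (θ : ℝ) : Fin 2 → Fin 2 → Op (Fin 2) :=
  ![![σZ, σX],
    ![(Real.cos (μ θ) : ℂ) • σZ + (Real.sin (μ θ) : ℂ) • σX,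
      (Real.cos (μ θ) : ℂ) • σZ - (Real.sin (μ θ) : ℂ) • σX]]

def φp (θ : ℝ) : Hil (Fin 2 → Fin 2) :=
  (Real.cos θ : ℂ) • ket ![0, 0] + (Real.sin θ : ℂ) • ket ![1, 1]

def φm (θ : ℝ) : Hil (Fin 2 → Fin 2) :=
  (Real.cos θ : ℂ) • ket ![1, 0] - (Real.sin θ : ℂ) • ket ![0, 1]

end Tilted

namespace WBC

def β (θ φ ω : ℝ) : ℝ := Real.sin θ * Real.sin (ω - φ) * Real.sin (θ + φ + ω)

def B₁ (θ φ ω : ℝ) : BellFunctional (Fin 2) :=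
  (1 / β θ φ ω) •
    ((Real.cos (θ + φ) * Real.cos (θ + ω)) • (Real.cos ω • cor 0 0 - Real.cos φ • cor 0 1) +
     (Real.cos φ * Real.cos ω) • (Real.cos (θ + φ) • cor 1 1 - Real.cos (θ + ω) • cor 1 0))

/-- The functional with the two settings of each party exchanged. -/
def swapSettings {V : Type} (B : BellFunctional V) : BellFunctional V :=
  fun s => B (fun v => (s v).map (Equiv.swap 0 1))

/-- `B₀[K] = B₁[K^{(1)}_1, K^{(1)}_0, K^{(2)}_1, K^{(2)}_0]`. -/
def B (θ φ ω : ℝ) : Fin 2 → BellFunctional (Fin 2) :=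
  ![swapSettings (B₁ θ φ ω), B₁ θ φ ω]

/-- `cos t σ₁ + sin t σ₂`. -/
def equatorial (t : ℝ) : Op (Fin 2) := (Real.cos t : ℂ) • σX + (Real.sin t : ℂ) • σY

def K (θ φ ω : ℝ) : Fin 2 → Fin 2 → Op (Fin 2) :=
  ![![σX, equatorial θ], ![equatorial φ, equatorial ω]]

def φp : Hil (Fin 2 → Fin 2) := ((1 / √2 : ℝ) : ℂ) • (ket ![0, 0] + Complex.I • ket ![1, 1])

def φm : Hil (Fin 2 → Fin 2) := ((1 / √2 : ℝ) : ℂ) • (ket ![0, 0] - Complex.I • ket ![1, 1])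

end WBC

/-! ### Graph states -/

namespace BASTA

variable {V : Type} [Fintype V] [DecidableEq V] (G : SimpleGraph V) [DecidableRel G.Adj]

/-- `K_x^{(i)} ⨂_{j ∈ n(i)} K_1^{(j)}`. -/
def centralTerm (i : V) (x : Fin 2) : BellFunctional V :=
  mono fun v => if v = i then some x else if G.Adj i v then some 1 else none

/-- `K_x^{(i)} ⊗ K_0^{(j)} ⨂_{k ∈ n(j), k ≠ i} K_1^{(k)}`. -/
def neighbourTerm (i j : V) (x : Fin 2) : BellFunctional V :=
  mono fun v => if v = i then some x else if v = j then some 0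
    else if G.Adj j v then some 1 else none

/-- `K_0^{(j)} ⨂_{k ∈ n(j)} K_1^{(k)}`. -/
def farTerm (j : V) : BellFunctional V :=
  mono fun v => if v = j then some 0 else if G.Adj j v then some 1 else none

/-- The functional `B(G, i)`. -/
def B (i : V) : BellFunctional V :=
  (G.degree i : ℝ) • (centralTerm G i 0 + centralTerm G i 1)
    + ∑ j ∈ G.neighborFinset i, (neighbourTerm G i j 0 - neighbourTerm G i j 1)
    + ∑ j with j ≠ i ∧ ¬ G.Adj i j, farTerm G j

/-- `K_x^{(i)} ⨂_{j ≠ i} K_1^{(j)}`. -/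
def fullTerm (i : V) (x : Fin 2) : BellFunctional V :=
  mono fun v => if v = i then some x else some 1

/-- `K_x^{(i)} ⊗ K_0^{(j)} ⨂_{k ∈ EN} K_1^{(k)}`, where `EN` is the set of the vertices that are
neighbours of both `i` and `j` or of neither (which excludes `i` and `j` if they are adjacent). -/
def evenTerm (i j : V) (x : Fin 2) : BellFunctional V :=
  mono fun v => if v = i then some x else if v = j then some 0
    else if (G.Adj i v ↔ G.Adj j v) then some 1 else none

/-- The functional `B'(G, i)`. -/
def B' (i : V) : BellFunctional V :=
  (G.degree i : ℝ) • (fullTerm i 0 - fullTerm i 1)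
    - ∑ j ∈ G.neighborFinset i, (evenTerm G i j 0 + evenTerm G i j 1)

def β₁ (i : V) : ℝ := (2 * √2 - 1) * G.degree i + Fintype.card V - 1

def β₀ (i : V) : ℝ := 2 * √2 * G.degree i

/-- The normalized functionals `B₀`, `B₁`. -/
def normalizedB (i : V) : Fin 2 → BellFunctional V :=
  ![(1 / β₀ G i) • B' G i, (1 / β₁ G i) • B G i]

/-- `K_0 = (X + Z)/√2`, `K_1 = (X - Z)/√2` at the vertex `i`, and `K_0 = X`, `K_1 = Z` elsewhere. -/
def K (i v : V) : Fin 2 → Op (Fin 2) :=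
  if v = i then ![((1 / √2 : ℝ) : ℂ) • (σX + σZ), ((1 / √2 : ℝ) : ℂ) • (σX - σZ)] else ![σX, σZ]

/-- The number of edges of `G` with both ends in `{v | x v = 1}`, that is, `∑_{ij ∈ E} x_i x_j`. -/
def edgeCount (x : V → Fin 2) : ℕ := (G.edgeFinset.filter fun e => ∀ v ∈ e, x v = 1).card

/-- The graph state `2^(-N/2) ∑_x (-1)^(∑_{ij ∈ E} x_i x_j) |x⟩`. -/
def φp : Hil (V → Fin 2) :=
  ((1 / √(2 ^ Fintype.card V) : ℝ) : ℂ) • ∑ x : V → Fin 2, (-1 : ℂ) ^ edgeCount G x • ket x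

/-- The antigraph state `2^(-N/2) ∑_x (-1)^(∑_{ij ∈ E} x_i x_j + ∑_i x_i) |x⟩`. -/
def φm : Hil (V → Fin 2) :=
  ((1 / √(2 ^ Fintype.card V) : ℝ) : ℂ) •
    ∑ x : V → Fin 2, (-1 : ℂ) ^ (edgeCount G x + ∑ v, (x v : ℕ)) • ket x

/-- The stabilizer operator `X_j ⨂_{k ∈ n(j)} Z_k`. -/
def stabilizer (j : V) : Op (V → Fin 2) :=
  tensorOp fun v => if v = j then σX else if G.Adj j v then σZ else 1

end BASTA

end

/-! ### Matrix elements and tensor products of operators -/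

/-! All four families follow one scheme, `givesComplex_of_intertwining`, which needs two inputs.

(a) The operator bound `-1 ≤ B_y[K] ≤ 1` for all measurements. It makes `(1 ± B_y[K])/2` a POVM on
the tensor product, so legs of a behaviour are contracted by regarding their holders as one party
who measures this POVM (`connectorOf_isMeasurement`, `connectorOf_isConnector`).

(b) An orthonormal pair whose span is invariant under the ideal operators, `B_y[K̄] V† = V† S_y`
with `S_y² = 1`. Since `V V† = 1`, the renormalized operators are the projections `(1 ± S_y)/2`.

For (a): the dichotomic operators of a POVM are only self-adjoint contractions, so the bounds are
proved in a C*-algebra for contractions, one party's commuting with the other's, as sums of positive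
terms in which the defects `1 - a²` appear. In `tilted_bound` the square of the Bell operator and
that of a companion operator add up to `β²`, up to defects; CHSH is the case `θ = π/4`. For WBC,
`bipartite_le_one` writes `1 - B` as a weighted sum of defects and of squares `(a_x - ∑ p_xy b_y)²`,
and the sign hypothesis on the cosines makes the weights positive. The BASTA functionals split into
one CHSH expression per neighbour of the distinguished vertex, plus, for `B`, one monomial per
remaining vertex.

For (b): in the tilted family the equations become polynomial in `sin θ`, `cos θ`, `β`. In WBC, a
product of equatorial observables exchanges `|00⟩` and `|11⟩` up to a phase depending only on the
sum of the angles. In BASTA, `K_0 ± K_1` at the distinguished vertex are `√2 X` and `√2 Z`, so `B`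
becomes a positive combination of stabilizers `S_j`, and `B'` one of `P = ⨂ Z` and the products `P
S_i S_j`. As `P` anticommutes with every `S_j` and exchanges the graph and antigraph states, the
latter has all stabilizer eigenvalues `-1`. -/

theorem inner_ket {ι : Type*} (i : ι) (f : Hil ι) : inner ℂ (ket i) f = f i := by
  classical
  have h := lp.inner_single_left (𝕜 := ℂ) (G := fun _ : ι => ℂ) i (1 : ℂ) f
  have e : ket i = lp.single (E := fun _ : ι => ℂ) 2 i (1 : ℂ) := by
    ext j
    rw [ket_apply, lp.single_apply, Pi.single_apply]
  rw [e, h]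
  simp

theorem op_ext_entries {ι κ : Type*} {S T : Hil ι →L[ℂ] Hil κ}
    (h : ∀ i j, (S (ket j)) i = (T (ket j)) i) : S = T :=
  op_ext_ket fun j => lp.ext (funext fun i => h i j)

theorem adjoint_entry {ι κ : Type*} (T : Hil ι →L[ℂ] Hil κ) (i : ι) (j : κ) :
    (T.adjoint (ket j)) i = star ((T (ket i)) j) := by
  rw [← inner_ket, ContinuousLinearMap.adjoint_inner_right, ← inner_conj_symm, inner_ket]
  rfl

theorem norm_leg_le {V : Type*} [DecidableEq V] {ι : V → Type*} (k : V) (A : Op (ι k)) :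
    ‖leg k A‖ ≤ ‖A‖ :=
  LinearMap.mkContinuous_norm_le _ (norm_nonneg _) _

section Tensor

variable {V : Type*} [Fintype V] {ι : V → Type*}

theorem tensorOp_one : tensorOp (fun v => (1 : Op (ι v))) = 1 := by
  classical
  refine op_ext_entries fun i j => ?_
  rw [tensorOp_ket]
  simp only [one_apply_eq_self, ket_apply]
  by_cases hij : i = j
  · simp [hij]
  · obtain ⟨v, hv⟩ := Function.ne_iff.1 hij
    rw [if_neg hij, Finset.prod_eq_zero (Finset.mem_univ v) (by simp [hv])]

theorem tensorOp_star (A : ∀ v, Op (ι v)) :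
    star (tensorOp A) = tensorOp fun v => star (A v) := by
  refine op_ext_entries fun i j => ?_
  rw [ContinuousLinearMap.star_eq_adjoint, adjoint_entry, tensorOp_ket, tensorOp_ket, star_prod]
  refine Finset.prod_congr rfl fun v _ => ?_
  rw [ContinuousLinearMap.star_eq_adjoint, adjoint_entry]

theorem tensorOp_isSelfAdjoint {A : ∀ v, Op (ι v)} (h : ∀ v, IsSelfAdjoint (A v)) :
    IsSelfAdjoint (tensorOp A) := by
  rw [isSelfAdjoint_iff, tensorOp_star]
  congr 1
  funext v
  exact h v

/-- The tensor product as a multilinear map. -/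
noncomputable def tensorMap (ι : V → Type*) :
    MultilinearMap ℂ (fun v => Op (ι v)) (Op (∀ v, ι v)) where
  toFun := tensorOp
  map_update_add' := by
    intro _ A k M N
    refine op_ext_entries fun i j => ?_
    change _ = (tensorOp _ (ket j)) i + (tensorOp _ (ket j)) i
    simp only [tensorOp_ket]
    rw [← Finset.mul_prod_erase _ _ (Finset.mem_univ k),
      ← Finset.mul_prod_erase _ (fun v => (Function.update A k M v (ket (j v))) (i v))
        (Finset.mem_univ k),
      ← Finset.mul_prod_erase _ (fun v => (Function.update A k N v (ket (j v))) (i v))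
        (Finset.mem_univ k)]
    have h : ∀ M : Op (ι k), ∏ v ∈ Finset.univ.erase k,
        (Function.update A k M v (ket (j v))) (i v)
          = ∏ v ∈ Finset.univ.erase k, (A v (ket (j v))) (i v) := fun M =>
      Finset.prod_congr rfl fun v hv => by rw [Function.update_of_ne (Finset.ne_of_mem_erase hv)]
    simp only [h, Function.update_self]
    rw [← add_mul]
    rfl
  map_update_smul' := by
    intro _ A k c M
    refine op_ext_entries fun i j => ?_
    change _ = c * (tensorOp _ (ket j)) i
    simp only [tensorOp_ket]
    rw [← Finset.mul_prod_erase _ _ (Finset.mem_univ k),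
      ← Finset.mul_prod_erase _ (fun v => (Function.update A k M v (ket (j v))) (i v))
        (Finset.mem_univ k)]
    have h : ∀ M : Op (ι k), ∏ v ∈ Finset.univ.erase k,
        (Function.update A k M v (ket (j v))) (i v)
          = ∏ v ∈ Finset.univ.erase k, (A v (ket (j v))) (i v) := fun M =>
      Finset.prod_congr rfl fun v hv => by rw [Function.update_of_ne (Finset.ne_of_mem_erase hv)]
    simp only [h, Function.update_self]
    rw [← mul_assoc]
    rfl

theorem tensorMap_apply (A : ∀ v, Op (ι v)) : tensorMap ι A = tensorOp A := rfl

theorem tensorOp_ket_of_monomial {A : ∀ v, Op (ι v)} {x x' : ∀ v, ι v} {c : V → ℂ}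
    (h : ∀ v, A v (ket (x v)) = c v • ket (x' v)) :
    tensorOp A (ket x) = (∏ v, c v) • ket x' := by
  classical
  ext i
  rw [tensorOp_ket]
  change _ = (∏ v, c v) * (ket x') i
  have h1 : ∀ v, (A v (ket (x v))) (i v) = c v * (ket (x' v)) (i v) := fun v => by
    rw [h]; rfl
  simp only [h1, Finset.prod_mul_distrib]
  congr 1
  rw [ket_apply]
  simp only [ket_apply]
  by_cases hij : i = x'
  · simp [hij]
  · obtain ⟨v, hv⟩ := Function.ne_iff.1 hij
    rw [if_neg hij, Finset.prod_eq_zero (Finset.mem_univ v) (by simp [hv])]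

variable [DecidableEq V]

/-- Restricted to a line in direction `k`, the image of a basis vector under a tensor product is a
multiple of the image under the `k`-th factor, so `leg k M` changes that factor alone. This lets
products and norms be treated one factor at a time. -/
theorem leg_mul_tensorOp (k : V) (M : Op (ι k)) (A : ∀ v, Op (ι v)) :
    leg k M * tensorOp A = tensorOp (Function.update A k (M * A k)) := by
  refine op_ext_entries fun i j => ?_
  set c : ℂ := ∏ v ∈ Finset.univ.erase k, (A v (ket (j v))) (i v) with hc
  have hl : lineRestrict k i (tensorOp A (ket j)) = c • A k (ket (j k)) := by
    ext t
    rw [lineRestrict_apply, tensorOp_ket, ← Finset.mul_prod_erase _ _ (Finset.mem_univ k),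
      Function.update_self, mul_comm]
    change _ = c * (A k (ket (j k))) t
    congr 1
    refine Finset.prod_congr rfl fun v hv => ?_
    rw [Function.update_of_ne (Finset.ne_of_mem_erase hv)]
  rw [mul_apply_eq_comp, leg_apply, hl, map_smul, tensorOp_ket,
    ← Finset.mul_prod_erase _ _ (Finset.mem_univ k), Function.update_self, mul_comm]
  change c * _ = _
  congr 1
  refine Finset.prod_congr rfl fun v hv => ?_
  rw [Function.update_of_ne (Finset.ne_of_mem_erase hv)]

theorem tensorOp_eq_leg_mul (k : V) (A : ∀ v, Op (ι v)) :
    tensorOp A = leg k (A k) * tensorOp (Function.update A k 1) := by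
  rw [leg_mul_tensorOp]
  simp

/-- Matrix elements of a product are sums over a possibly infinite basis. Peeling off one leg at a
time avoids them; the induction is on a finite set outside which the left family is trivial. -/
theorem tensorOp_mul (A B : ∀ v, Op (ι v)) :
    tensorOp A * tensorOp B = tensorOp fun v => A v * B v := by
  suffices h : ∀ s : Finset V, ∀ A B : ∀ v, Op (ι v), (∀ v ∉ s, A v = 1) →
      tensorOp A * tensorOp B = tensorOp fun v => A v * B v from
    h Finset.univ A B (by simp)
  intro s
  induction s using Finset.induction_on with
  | empty =>
    intro A B h
    obtain rfl : A = fun _ => 1 := funext fun v => h v (by simp)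
    simp [tensorOp_one]
  | insert k s hk ih =>
    intro A B h
    rw [tensorOp_eq_leg_mul k A, mul_assoc, ih, leg_mul_tensorOp]
    · congr 1
      funext v
      by_cases hv : v = k
      · subst hv; simp
      · simp [hv]
    · intro v hv
      by_cases hvk : v = k
      · subst hvk; simp
      · rw [Function.update_of_ne hvk]
        exact h v (by simp [hv, hvk])

/-- The norm is not visible in the matrix elements, but the tensor product is a product of legs,
each a contraction. -/
theorem norm_tensorOp_le_one {A : ∀ v, Op (ι v)} (hA : ∀ v, ‖A v‖ ≤ 1) :
    ‖tensorOp A‖ ≤ 1 := by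
  suffices h : ∀ s : Finset V, ∀ A : ∀ v, Op (ι v), (∀ v, ‖A v‖ ≤ 1) → (∀ v ∉ s, A v = 1) →
      ‖tensorOp A‖ ≤ 1 from h Finset.univ A hA (by simp)
  intro s
  induction s using Finset.induction_on with
  | empty =>
    intro A _ h
    obtain rfl : A = fun _ => 1 := funext fun v => h v (by simp)
    rw [tensorOp_one]
    exact ContinuousLinearMap.norm_id_le
  | insert k s hk ih =>
    intro A hA h
    rw [tensorOp_eq_leg_mul k A]
    refine (norm_mul_le _ _).trans (mul_le_one₀ ((norm_leg_le k _).trans (hA k))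
      (norm_nonneg _) (ih _ ?_ ?_))
    · intro v
      by_cases hvk : v = k
      · subst hvk
        rw [Function.update_self]
        exact ContinuousLinearMap.norm_id_le
      · rw [Function.update_of_ne hvk]
        exact hA v
    · intro v hv
      by_cases hvk : v = k
      · subst hvk; simp
      · rw [Function.update_of_ne hvk]
        exact h v (by simp [hv, hvk])

end Tensor

/-! ### Relabelling the standard basis -/

/-- The unitary `ℓ²(α) ≃ ℓ²(β)` of a bijection of the index sets. -/
noncomputable def hilReindex {α β : Type*} (e : α ≃ β) : Hil α ≃ₗᵢ[ℂ] Hil β where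
  toFun f := ⟨fun b => f (e.symm b), memℓp_gen
    (((lp.memℓp f).summable (by norm_num)).comp_injective e.symm.injective)⟩
  invFun f := ⟨fun a => f (e a), memℓp_gen
    (((lp.memℓp f).summable (by norm_num)).comp_injective e.injective)⟩
  map_add' _ _ := rfl
  map_smul' _ _ := rfl
  left_inv f := by ext a; exact congrArg f (e.symm_apply_apply a)
  right_inv f := by ext a; exact congrArg f (e.apply_symm_apply a)
  norm_map' f := by
    have hp : 0 < (2 : ℝ≥0∞).toReal := by norm_num
    rw [lp.norm_eq_tsum_rpow hp, lp.norm_eq_tsum_rpow hp]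
    congr 1
    exact e.symm.tsum_eq fun a => ‖f a‖ ^ (2 : ℝ≥0∞).toReal

theorem hilReindex_apply {α β : Type*} (e : α ≃ β) (f : Hil α) (b : β) :
    (hilReindex e f) b = f (e.symm b) := rfl

theorem hilReindex_ket {α β : Type*} (e : α ≃ β) (a : α) :
    hilReindex e (ket a) = ket (e a) := by
  classical
  ext b
  rw [hilReindex_apply, ket_apply, ket_apply]
  simp [Equiv.symm_apply_eq]

theorem hilReindex_intertwine {α β : Type*} (e : α ≃ β) {S : Op α} {T : Op β}
    (h : ∀ i j, (T (ket (e j))) (e i) = (S (ket j)) i) (f : Hil α) :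
    T (hilReindex e f) = hilReindex e (S f) := by
  have : T ∘L (hilReindex e).toContinuousLinearEquiv.toContinuousLinearMap =
      (hilReindex e).toContinuousLinearEquiv.toContinuousLinearMap ∘L S := by
    refine op_ext_entries fun b j => ?_
    change (T (hilReindex e (ket j))) b = (hilReindex e (S (ket j))) b
    rw [hilReindex_ket, hilReindex_apply, ← h, Equiv.apply_symm_apply]
  exact congrArg (fun F => F f) this

/-! ### Operator bounds for commuting self-adjoint contractions -/

section Bounds

variable {𝓐 : Type*} [CStarAlgebra 𝓐]

/-- A self-adjoint contraction: the operator of a `±1`-valued observable. -/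
structure IsObservable (a : 𝓐) : Prop where
  isSelfAdjoint : IsSelfAdjoint a
  norm_le : ‖a‖ ≤ 1

theorem IsObservable.neg {a : 𝓐} (ha : IsObservable a) : IsObservable (-a) :=
  ⟨ha.1.neg, by rw [norm_neg]; exact ha.2⟩

variable [PartialOrder 𝓐] [StarOrderedRing 𝓐]

theorem IsObservable.one_sub_nonneg {a : 𝓐} (ha : IsObservable a) : 0 ≤ 1 - a := by
  refine sub_nonneg.2 ((ha.1.le_algebraMap_norm_self).trans ?_)
  rw [← map_one (algebraMap ℝ 𝓐)]
  exact algebraMap_mono 𝓐 ha.2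

theorem IsObservable.one_add_nonneg {a : 𝓐} (ha : IsObservable a) : 0 ≤ 1 + a := by
  simpa using ha.neg.one_sub_nonneg

theorem IsObservable.one_sub_sq_nonneg {a : 𝓐} (ha : IsObservable a) : 0 ≤ 1 - a * a := by
  refine sub_nonneg.2 ?_
  have h := CStarAlgebra.star_mul_le_algebraMap_norm_sq (a := a)
  rw [ha.1.star_eq] at h
  refine h.trans ?_
  rw [← map_one (algebraMap ℝ 𝓐)]
  exact algebraMap_mono 𝓐 (pow_le_one₀ (norm_nonneg _) ha.2)

/-- The positive elements `1 - a` and `1 + a` commute, so their product `1 - a²` is positive; the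
C*-identity turns `a* a ≤ 1` into `‖a‖ ≤ 1`. -/
theorem isObservable_of_nonneg {a : 𝓐} (h₁ : 0 ≤ 1 - a) (h₂ : 0 ≤ 1 + a) : IsObservable a := by
  have hs : IsSelfAdjoint a := by
    have := (IsSelfAdjoint.of_nonneg h₂).sub (IsSelfAdjoint.one 𝓐)
    simpa using this
  refine ⟨hs, ?_⟩
  have hc : Commute (1 - a) (1 + a) := by
    change (1 - a) * (1 + a) = (1 + a) * (1 - a)
    noncomm_ring
  have h : 0 ≤ 1 - a * a := by
    have := hc.mul_nonneg h₁ h₂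
    convert this using 1
    noncomm_ring
  have h3 := (CStarAlgebra.norm_le_one_iff_of_nonneg (star a * a) (star_mul_self_nonneg a)).2
    (by rw [hs.star_eq]; exact sub_nonneg.1 h)
  rw [CStarRing.norm_star_mul_self] at h3
  nlinarith [norm_nonneg a]

theorem IsSelfAdjoint.sq_nonneg' {a : 𝓐} (ha : IsSelfAdjoint a) : 0 ≤ a * a := by
  simpa [ha.star_eq] using star_mul_self_nonneg a

theorem ofReal_smul_nonneg {c : ℝ} (hc : 0 ≤ c) {a : 𝓐} (ha : 0 ≤ a) : 0 ≤ (c : ℂ) • a := by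
  rw [Complex.coe_smul]
  exact smul_nonneg hc ha

/-- Both bounds come from `(β - Y)² + (β² - Y²) = 2β (β - Y)`, used for `Y = X` and `Y = -X`. -/
theorem bounds_of_sq_le {X : 𝓐} {β : ℝ} (hβ : 0 < β) (hX : IsSelfAdjoint X)
    (h : 0 ≤ β ^ 2 • (1 : 𝓐) - X * X) : 0 ≤ β • 1 - X ∧ 0 ≤ β • 1 + X := by
  have key : ∀ Y : 𝓐, IsSelfAdjoint Y → 0 ≤ β ^ 2 • (1 : 𝓐) - Y * Y → 0 ≤ β • 1 - Y := by
    intro Y hY h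
    have hs : IsSelfAdjoint (β • (1 : 𝓐) - Y) := ((IsSelfAdjoint.all β).smul (.one 𝓐)).sub hY
    have h1 := smul_nonneg (inv_nonneg.2 (by positivity : 0 ≤ 2 * β))
      (add_nonneg hs.sq_nonneg' h)
    convert h1 using 1
    have h2 : (β • (1 : 𝓐) - Y) * (β • 1 - Y) + (β ^ 2 • 1 - Y * Y)
        = (2 * β) • (β • (1 : 𝓐) - Y) := by
      simp only [mul_sub, sub_mul, smul_mul_assoc, mul_smul_comm, one_mul, mul_one]
      module
    rw [h2, smul_smul, inv_mul_cancel₀ (by positivity), one_smul]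
  refine ⟨key X hX h, ?_⟩
  simpa using key (-X) hX.neg (by simpa using h)

/-- Since `-2 ≤ b₀ + b₁ ≤ 2`, the expression is at least `(2 - |c|)²`. -/
theorem observable_pair_nonneg (c : ℝ) {b₀ b₁ : 𝓐} (h₀ : IsObservable b₀) (h₁ : IsObservable b₁) :
    0 ≤ (4 + c ^ 2) • (1 : 𝓐) + (2 * c) • (b₀ + b₁) := by
  have one_nonneg : (0 : 𝓐) ≤ 1 := by simp
  rcases le_total 0 c with hc | hc
  · have h := add_nonneg (smul_nonneg (sq_nonneg (2 - c)) one_nonneg)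
      (smul_nonneg (by positivity : 0 ≤ 2 * c) (add_nonneg h₀.one_add_nonneg h₁.one_add_nonneg))
    convert h using 1
    module
  · have h := add_nonneg (smul_nonneg (sq_nonneg (2 + c)) one_nonneg)
      (smul_nonneg (by linarith : 0 ≤ -(2 * c)) (add_nonneg h₀.one_sub_nonneg h₁.one_sub_nonneg))
    convert h using 1
    module

/-- The maximal quantum value `√(8 + 2 α²)` of the tilted CHSH expression. -/
theorem tilted_bound {α β : ℝ} (hβ : 0 < β) (hαβ : β ^ 2 = 8 + 2 * α ^ 2) {a₀ a₁ b₀ b₁ : 𝓐}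
    (ha₀ : IsObservable a₀) (ha₁ : IsObservable a₁) (hb₀ : IsObservable b₀)
    (hb₁ : IsObservable b₁) (h₀₀ : Commute a₀ b₀) (h₀₁ : Commute a₀ b₁) (h₁₀ : Commute a₁ b₀)
    (h₁₁ : Commute a₁ b₁) :
    0 ≤ (β : ℂ) • 1 - ((α : ℂ) • a₀ + a₀ * b₀ + a₁ * b₀ + a₀ * b₁ - a₁ * b₁) ∧
    0 ≤ (β : ℂ) • 1 + ((α : ℂ) • a₀ + a₀ * b₀ + a₁ * b₀ + a₀ * b₁ - a₁ * b₁) := by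
  simp only [Complex.coe_smul]
  have sa : ∀ {a b : 𝓐}, IsObservable a → IsObservable b → Commute a b → IsSelfAdjoint (a * b) :=
    fun ha hb h => (ha.1.commute_iff hb.1).1 h
  have s₀₀ := sa ha₀ hb₀ h₀₀
  have s₀₁ := sa ha₀ hb₁ h₀₁
  have s₁₀ := sa ha₁ hb₀ h₁₀
  have s₁₁ := sa ha₁ hb₁ h₁₁
  refine bounds_of_sq_le hβ
    (((((((IsSelfAdjoint.all α).smul ha₀.1).add s₀₀).add s₁₀).add s₀₁)).sub s₁₁) ?_
  -- The companion `T = α a₁ - a₁(b₀ + b₁) - a₀(b₀ - b₁)` of the Bell operator `X`. When all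
  -- observables square to `1`, `X² + T² = 8 + 2α²`: the terms linear in `α` and the commutators of
  -- `b₀`, `b₁` cancel.
  have hT := ((((((IsSelfAdjoint.all α).smul ha₁.1).sub s₁₀).sub s₁₁).sub s₀₀).add s₀₁).sq_nonneg'
  have conj : ∀ {s b : 𝓐}, IsSelfAdjoint s → IsObservable b → 0 ≤ s * (1 - b * b) * s := by
    intro s b hs hb
    simpa [hs.star_eq] using star_left_conjugate_nonneg hb.one_sub_sq_nonneg s
  -- For contractions, defects remain: `1 - b_y²` sandwiched between `a₀ ± a₁`, and `1 - a_x²` times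
  -- the positive, commuting elements `4 + α² ± 2α(b₀ + b₁)`.
  have hp := smul_nonneg (by norm_num : (0 : ℝ) ≤ 2) (conj (ha₀.1.add ha₁.1) hb₀)
  have hm := smul_nonneg (by norm_num : (0 : ℝ) ≤ 2) (conj (ha₀.1.sub ha₁.1) hb₁)
  have comm : ∀ {a : 𝓐} (c : ℝ), Commute a b₀ → Commute a b₁ →
      Commute (1 - a * a) ((4 + c ^ 2) • (1 : 𝓐) + (2 * c) • (b₀ + b₁)) := by
    intro a c h h'
    refine ((Commute.one_left _).sub_left (Commute.mul_left ?_ ?_)) <;>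
    exact ((Commute.one_right a).smul_right _).add_right ((h.add_right h').smul_right _)
  have h0 := (comm α h₀₀ h₀₁).mul_nonneg ha₀.one_sub_sq_nonneg (observable_pair_nonneg α hb₀ hb₁)
  have h1 := (comm (-α) h₁₀ h₁₁).mul_nonneg ha₁.one_sub_sq_nonneg
    (observable_pair_nonneg (-α) hb₀ hb₁)
  convert add_nonneg hT (add_nonneg (add_nonneg hp hm) (add_nonneg h0 h1)) using 1
  have e₀₀ := h₀₀.eq.symm
  have e₀₁ := h₀₁.eq.symm
  have e₁₀ := h₁₀.eq.symm
  have e₁₁ := h₁₁.eq.symm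
  have l : ∀ {a b : 𝓐}, b * a = a * b → ∀ z, b * (a * z) = a * (b * z) := fun h z => by
    rw [← mul_assoc, h, mul_assoc]
  rw [hαβ]
  simp only [mul_add, add_mul, mul_sub, sub_mul, smul_mul_assoc, mul_smul_comm, one_mul, mul_one,
    mul_assoc, e₀₀, e₀₁, e₁₀, e₁₁, l e₀₀, l e₀₁, l e₁₀, l e₁₁, smul_add, smul_sub]
  module

theorem chsh_bound {a₀ a₁ b₀ b₁ : 𝓐}
    (ha₀ : IsObservable a₀) (ha₁ : IsObservable a₁) (hb₀ : IsObservable b₀)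
    (hb₁ : IsObservable b₁) (h₀₀ : Commute a₀ b₀) (h₀₁ : Commute a₀ b₁) (h₁₀ : Commute a₁ b₀)
    (h₁₁ : Commute a₁ b₁) :
    0 ≤ ((2 * √2 : ℝ) : ℂ) • 1 - (a₀ * b₀ + a₁ * b₀ + a₀ * b₁ - a₁ * b₁) ∧
    0 ≤ ((2 * √2 : ℝ) : ℂ) • 1 + (a₀ * b₀ + a₁ * b₀ + a₀ * b₁ - a₁ * b₁) := by
  have h := tilted_bound (α := 0) (β := 2 * √2) (by positivity)
    (by rw [mul_pow, Real.sq_sqrt (by norm_num)]; norm_num) ha₀ ha₁ hb₀ hb₁ h₀₀ h₀₁ h₁₀ h₁₁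
  simpa using h

/-- A bound for a bipartite correlation expression from a dual feasible point. -/
theorem bipartite_le_one {l₀ l₁ p₀₀ p₀₁ p₁₀ p₁₁ : ℝ} (hl₀ : 0 ≤ l₀) (hl₁ : 0 ≤ l₁)
    (hcross : l₀ * p₀₀ * p₀₁ + l₁ * p₁₀ * p₁₁ = 0)
    (hsum : l₀ + l₁ + (l₀ * p₀₀ ^ 2 + l₁ * p₁₀ ^ 2) + (l₀ * p₀₁ ^ 2 + l₁ * p₁₁ ^ 2) = 2)
    {a₀ a₁ b₀ b₁ : 𝓐}
    (ha₀ : IsObservable a₀) (ha₁ : IsObservable a₁) (hb₀ : IsObservable b₀)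
    (hb₁ : IsObservable b₁) (h₀₀ : Commute a₀ b₀) (h₀₁ : Commute a₀ b₁) (h₁₀ : Commute a₁ b₀)
    (h₁₁ : Commute a₁ b₁) :
    0 ≤ 1 - ((l₀ * p₀₀) • (a₀ * b₀) + (l₀ * p₀₁) • (a₀ * b₁) + (l₁ * p₁₀) • (a₁ * b₀)
      + (l₁ * p₁₁) • (a₁ * b₁)) := by
  -- Twice the target is `∑ l_x [(1 - a_x²) + (a_x - p_x0 b₀ - p_x1 b₁)²]` plus the defects `1 -
  -- b_y²` with weights `∑ l_x p_xy²`. `hcross` removes `b₀b₁ + b₁b₀`, and `hsum` fixes the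
  -- constant.
  have sq : ∀ {a : 𝓐} (p q : ℝ), IsSelfAdjoint a →
      0 ≤ (a - (p • b₀ + q • b₁)) * (a - (p • b₀ + q • b₁)) := fun p q ha =>
    (ha.sub (((IsSelfAdjoint.all p).smul hb₀.1).add ((IsSelfAdjoint.all q).smul hb₁.1))).sq_nonneg'
  have t1 := add_nonneg (smul_nonneg hl₀ (add_nonneg ha₀.one_sub_sq_nonneg (sq p₀₀ p₀₁ ha₀.1)))
    (smul_nonneg hl₁ (add_nonneg ha₁.one_sub_sq_nonneg (sq p₁₀ p₁₁ ha₁.1)))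
  have t2 := add_nonneg
    (smul_nonneg (by positivity : 0 ≤ l₀ * p₀₀ ^ 2 + l₁ * p₁₀ ^ 2) hb₀.one_sub_sq_nonneg)
    (smul_nonneg (by positivity : 0 ≤ l₀ * p₀₁ ^ 2 + l₁ * p₁₁ ^ 2) hb₁.one_sub_sq_nonneg)
  have t := smul_nonneg (by norm_num : (0 : ℝ) ≤ 1 / 2) (add_nonneg t1 t2)
  convert t using 1
  have e₀₀ := h₀₀.eq.symm
  have e₀₁ := h₀₁.eq.symm
  have e₁₀ := h₁₀.eq.symm
  have e₁₁ := h₁₁.eq.symm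
  simp only [mul_add, add_mul, mul_sub, sub_mul, smul_mul_assoc, mul_smul_comm,
    e₀₀, e₀₁, e₁₀, e₁₁, smul_add, smul_sub]
  linear_combination (norm := module) (-1 / 2 : ℝ) • hsum • (1 : 𝓐) - (1 / 2 : ℝ) • hcross • (b₀ * b₁)
    - (1 / 2 : ℝ) • hcross • (b₁ * b₀)

theorem bipartite_bound {l₀ l₁ p₀₀ p₀₁ p₁₀ p₁₁ : ℝ} (hl₀ : 0 ≤ l₀) (hl₁ : 0 ≤ l₁)
    (hcross : l₀ * p₀₀ * p₀₁ + l₁ * p₁₀ * p₁₁ = 0)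
    (hsum : l₀ + l₁ + (l₀ * p₀₀ ^ 2 + l₁ * p₁₀ ^ 2) + (l₀ * p₀₁ ^ 2 + l₁ * p₁₁ ^ 2) = 2)
    {a₀ a₁ b₀ b₁ : 𝓐}
    (ha₀ : IsObservable a₀) (ha₁ : IsObservable a₁) (hb₀ : IsObservable b₀)
    (hb₁ : IsObservable b₁) (h₀₀ : Commute a₀ b₀) (h₀₁ : Commute a₀ b₁) (h₁₀ : Commute a₁ b₀)
    (h₁₁ : Commute a₁ b₁) :
    0 ≤ 1 - (((l₀ * p₀₀ : ℝ) : ℂ) • (a₀ * b₀) + ((l₀ * p₀₁ : ℝ) : ℂ) • (a₀ * b₁) + ((l₁ * p₁₀ : ℝ) : ℂ) • (a₁ * b₀)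
      + ((l₁ * p₁₁ : ℝ) : ℂ) • (a₁ * b₁)) ∧
    0 ≤ 1 + (((l₀ * p₀₀ : ℝ) : ℂ) • (a₀ * b₀) + ((l₀ * p₀₁ : ℝ) : ℂ) • (a₀ * b₁) + ((l₁ * p₁₀ : ℝ) : ℂ) • (a₁ * b₀)
      + ((l₁ * p₁₁ : ℝ) : ℂ) • (a₁ * b₁)) := by
  simp only [Complex.coe_smul]
  refine ⟨bipartite_le_one hl₀ hl₁ hcross hsum ha₀ ha₁ hb₀ hb₁ h₀₀ h₀₁ h₁₀ h₁₁, ?_⟩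
  convert bipartite_le_one hl₀ hl₁ hcross hsum ha₀.neg ha₁.neg hb₀ hb₁ h₀₀.neg_left h₀₁.neg_left
    h₁₀.neg_left h₁₁.neg_left using 1
  simp only [neg_mul]
  module

end Bounds

/-! ### Bell operators and their connectors -/

theorem Op.nonneg_iff {ι : Type*} {T : Op ι} : 0 ≤ T ↔ T.IsPositive :=
  ContinuousLinearMap.nonneg_iff_isPositive T

theorem sum_units_int {M : Type*} [AddCommMonoid M] (f : ℤˣ → M) : ∑ a, f a = f 1 + f (-1) := by
  rw [show (Finset.univ : Finset ℤˣ) = {1, -1} from rfl, Finset.sum_pair (by decide)]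

/-- `1 - K_x` and `1 + K_x` are twice the two POVM elements. Nothing projective is assumed, so `K_x²
= 1` is not available. -/
theorem correlator_isObservable {ι : Type*} {A : ℤˣ → Fin 2 → Op ι} (hA : IsMeasurement A)
    (x : Fin 2) : IsObservable (correlator A x) := by
  have h := hA.2 x
  rw [sum_units_int] at h
  have pos : ∀ a, 0 ≤ ((2 : ℝ) : ℂ) • A a x := fun a =>
    ofReal_smul_nonneg (by norm_num) (Op.nonneg_iff.2 (hA.1 a x))
  refine isObservable_of_nonneg ?_ ?_
  · convert pos (-1) using 1
    rw [← h, correlator, Complex.ofReal_ofNat]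
    module
  · convert pos 1 using 1
    rw [← h, correlator, Complex.ofReal_ofNat]
    module

section BellOp

variable {V : Type} [Fintype V] [DecidableEq V] {ι : V → Type*}

/-- The Bell operator as a (semi)linear function of the Bell functional. -/
noncomputable def opLin (K : ∀ v, Fin 2 → Op (ι v)) :
    BellFunctional V →ₛₗ[Complex.ofRealHom] Op (∀ v, ι v) where
  toFun B := B.op K
  map_add' B B' := by
    simp only [BellFunctional.op, Pi.add_apply, Complex.ofReal_add, add_smul,
      Finset.sum_add_distrib]
  map_smul' c B := by
    simp only [BellFunctional.op, Pi.smul_apply, smul_eq_mul, Complex.ofReal_mul, mul_smul,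
      Finset.smul_sum, Complex.ofRealHom_eq_coe]

theorem opLin_smul (K : ∀ v, Fin 2 → Op (ι v)) (c : ℝ) (B : BellFunctional V) :
    opLin K (c • B) = (c : ℂ) • opLin K B := map_smulₛₗ _ _ _

theorem opLin_apply (K : ∀ v, Fin 2 → Op (ι v)) (B : BellFunctional V) : opLin K B = B.op K := rfl

theorem opLin_mono (K : ∀ v, Fin 2 → Op (ι v)) (s : V → Option (Fin 2)) :
    opLin K (mono s) = tensorOp fun v => (s v).elim 1 (K v) := by
  rw [opLin_apply, BellFunctional.op, Finset.sum_eq_single s]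
  · simp [mono]
  · intro t _ ht
    simp [mono, ht]
  · simp

/-- Each slot is written as a combination of POVM elements and the tensor product is expanded
multilinearly. The identity slot becomes `∑_a A_{a|0}`, which is where completeness of the
measurements enters. -/
theorem sum_toTensor (B : BellFunctional V) {A : ∀ v, ℤˣ → Fin 2 → Op (ι v)}
    (hA : ∀ v, IsMeasurement (A v)) :
    ∑ a : V → ℤˣ, ∑ x : V → Fin 2, (B.toTensor a x : ℂ) • tensorOp (fun v => A v (a v) (x v))
      = B.op fun v => correlator (A v) := by
  set w : Option (Fin 2) → ℤˣ → Fin 2 → ℝ := fun s a x => s.elim (if x = 0 then 1 else 0)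
    (fun t => if x = t then ((a : ℤ) : ℝ) else 0) with hw
  have slot : ∀ v (s : Option (Fin 2)),
      ∑ a : ℤˣ, ∑ x : Fin 2, (w s a x : ℂ) • A v a x = s.elim 1 (correlator (A v)) := by
    intro v s
    cases s with
    | none => simpa [hw, sum_units_int, -Complex.coe_smul] using (hA v).2 0
    | some t =>
      rw [sum_units_int]
      fin_cases t <;> simp [hw, correlator, sub_eq_add_neg, -Complex.coe_smul]
  have expand : ∀ s : V → Option (Fin 2),
      tensorOp (fun v => (s v).elim 1 (correlator (A v)))
        = ∑ a : V → ℤˣ, ∑ x : V → Fin 2, ((∏ v, w (s v) (a v) (x v) : ℝ) : ℂ) •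
          tensorOp (fun v => A v (a v) (x v)) := by
    intro s
    simp only [← slot]
    rw [← tensorMap_apply, MultilinearMap.map_sum]
    refine Finset.sum_congr rfl fun a _ => ?_
    rw [MultilinearMap.map_sum]
    refine Finset.sum_congr rfl fun x _ => ?_
    rw [MultilinearMap.map_smul_univ, tensorMap_apply]
    push_cast
    rfl
  rw [BellFunctional.op]
  simp only [expand, Finset.smul_sum]
  conv_rhs => rw [Finset.sum_comm]
  refine Finset.sum_congr rfl fun a _ => ?_
  conv_rhs => rw [Finset.sum_comm]
  refine Finset.sum_congr rfl fun x _ => ?_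
  rw [BellFunctional.toTensor]
  push_cast
  rw [Finset.sum_smul]
  refine Finset.sum_congr rfl fun s _ => ?_
  rw [smul_smul]

theorem connectorOf_apply (B : Fin 2 → BellFunctional V) {A : ∀ v, ℤˣ → Fin 2 → Op (ι v)}
    (hA : ∀ v, IsMeasurement (A v)) (b : ℤˣ) (y : Fin 2) :
    (connectorOf B).apply A b y =
      (1 / 2 : ℂ) • (1 + ((b : ℤ) : ℂ) • (B y).op (fun v => correlator (A v))) := by
  refine (sum_toTensor _ hA).trans ?_
  rw [← opLin_apply, opLin_smul, map_add, opLin_smul, opLin_mono, opLin_apply]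
  simp only [Option.elim_none, tensorOp_one]
  push_cast
  rfl

end BellOp

/-- Grouping the first family of tensor factors into one. -/
def groupLeft {V W : Type} (ι : V → Type u) (κ : W → Type u) :
    (∀ s : V ⊕ W, Sum.elim ι κ s) ≃ ∀ s : Unit ⊕ W, Sum.elim (fun _ : Unit => ∀ v, ι v) κ s where
  toFun f
    | Sum.inl _ => fun v => f (Sum.inl v)
    | Sum.inr w => f (Sum.inr w)
  invFun g
    | Sum.inl v => g (Sum.inl ()) v
    | Sum.inr w => g (Sum.inr w)
  left_inv f := by
    funext s
    cases s <;> rfl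
  right_inv g := by
    funext s
    cases s <;> rfl

/-! ### Merging the parties on the contracted legs into one -/

section Group

variable {V W : Type} [Fintype V] [Fintype W] {ι : V → Type u} {κ : W → Type u}

/-- Merging parties only relabels the product basis, and the matrix elements on both sides are the
same product. -/
theorem tensorOp_groupLeft (A : ∀ v, Op (ι v)) (D : ∀ w, Op (κ w))
    (f : Hil (∀ s : V ⊕ W, Sum.elim ι κ s)) :
    tensorOp (joinOps (fun _ : Unit => tensorOp A) D) (hilReindex (groupLeft ι κ) f)
      = hilReindex (groupLeft ι κ) (tensorOp (joinOps A D) f) := by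
  refine hilReindex_intertwine _ (fun i j => ?_) f
  rw [tensorOp_ket, tensorOp_ket, Fintype.prod_sum_type, Fintype.prod_sum_type,
    Fintype.prod_unique]
  congr 1
  exact tensorOp_ket A (fun v => i (Sum.inl v)) (fun v => j (Sum.inl v))

/-- `M ↦ M ⊗ ⨂ D`. -/
noncomputable def joinLin (η : Type u) (D : ∀ w, Op (κ w)) :
    Op η →ₗ[ℂ] Op (∀ s : Unit ⊕ W, Sum.elim (fun _ => η) κ s) := by
  classical
  exact (tensorMap (Sum.elim (fun _ : Unit => η) κ)).toLinearMap
    (joinOps (fun _ : Unit => (0 : Op η)) D) (Sum.inl ())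

theorem joinLin_apply (η : Type u) (D : ∀ w, Op (κ w)) (M : Op η) :
    joinLin η D M = tensorOp (joinOps (fun _ : Unit => M) D) := by
  classical
  change tensorOp _ = _
  congr 1
  funext s
  cases s with
  | inl t => exact Function.update_self _ _ _
  | inr w => exact Function.update_of_ne (by simp) _ _

end Group

/-! ### Normalized Bell functionals define connectors -/

section Connector

variable {V : Type} [Fintype V] [DecidableEq V]

theorem connectorOf_isMeasurement {B : Fin 2 → BellFunctional V}
    (hB : ∀ y, BellFunctional.BoundedBy.{u} 1 (B y)) {ι : V → Type u}
    {A : ∀ v, ℤˣ → Fin 2 → Op (ι v)} (hA : ∀ v, IsMeasurement (A v)) :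
    IsMeasurement fun b y => (connectorOf B).apply A b y := by
  constructor
  · intro b y
    beta_reduce
    rw [connectorOf_apply B hA]
    obtain ⟨h₁, h₂⟩ := hB y ι A hA
    rw [← Op.nonneg_iff] at h₁ h₂ ⊢
    have e : (1 / 2 : ℂ) = ((1 / 2 : ℝ) : ℂ) := by push_cast; rfl
    rw [e]
    refine ofReal_smul_nonneg (by norm_num) ?_
    rcases Int.units_eq_one_or b with rfl | rfl
    · simpa using h₂
    · simpa [sub_eq_add_neg] using h₁
  · intro y
    beta_reduce
    rw [sum_units_int, connectorOf_apply B hA, connectorOf_apply B hA, ← smul_add]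
    simp only [Units.val_one, Int.cast_one, Units.val_neg, Int.cast_neg]
    module

/-- The contracted behaviour is realized by a single party on the joint space of the legs, measuring
`C_{b|y}[A]`, with the other measurements unchanged and the state regrouped. The probabilities agree
because the Born rule is linear in the operator on the legs. -/
theorem connectorOf_isConnector {B : Fin 2 → BellFunctional V}
    (hB : ∀ y, BellFunctional.BoundedBy.{u} 1 (B y)) :
    ConnectorTensor.IsConnector.{u} (connectorOf B) := by
  refine ⟨?_, fun ι A hA => (connectorOf_isMeasurement hB hA).2⟩
  rintro W O' X' _ _ P ⟨ι, κ, A, D, ψ, hA, hD, hψ, hP⟩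
  refine ⟨fun _ => ∀ v, ι v, κ, fun _ b y => (connectorOf B).apply A b y, D,
    fun n => hilReindex (groupLeft ι κ) (ψ n), fun _ => connectorOf_isMeasurement hB hA, hD,
    by simpa only [LinearIsometryEquiv.norm_map] using hψ, fun b y c z => ?_⟩
  push_cast
  have h := hasSum_sum fun a (_ : a ∈ (Finset.univ : Finset (V → ℤˣ))) =>
    hasSum_sum fun x (_ : x ∈ (Finset.univ : Finset (V → Fin 2))) =>
      (hP a x c z).mul_left (connectorOf B (b ()) (y ()) a x : ℂ)
  refine (congrArg (HasSum · _) (funext fun n => ?_)).mpr h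
  rw [show (fun v : Unit => (connectorOf B).apply A (b v) (y v))
    = fun _ => (connectorOf B).apply A (b ()) (y ()) from rfl, ← joinLin_apply,
    ConnectorTensor.apply]
  simp only [map_sum, map_smul, joinLin_apply]
  simp only [sum_apply, inner_sum]
  refine Finset.sum_congr rfl fun a _ => Finset.sum_congr rfl fun x _ => ?_
  rw [smul_apply, inner_smul_right, tensorOp_groupLeft,
    LinearIsometryEquiv.inner_map_map]

end Connector

/-! ### Connector complexes from a pair of orthonormal vectors -/

theorem dichotomic_isMeasurement {ι : Type*} {K : Fin 2 → Op ι} (hs : ∀ x, IsSelfAdjoint (K x))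
    (hu : ∀ x, K x * K x = 1) : IsMeasurement (dichotomic K) ∧
      ∀ b x, IsStarProjection (dichotomic K b x) := by
  have hproj : ∀ b x, IsStarProjection (dichotomic K b x) := by
    intro b x
    refine ⟨?_, ?_⟩
    · change _ * _ = _
      have hb : (((b : ℤ) : ℂ)) * ((b : ℤ) : ℂ) = 1 := by
        rcases Int.units_eq_one_or b with rfl | rfl <;> simp
      simp only [dichotomic, smul_mul_assoc, mul_smul_comm, add_mul, mul_add, one_mul, mul_one,
        hu, smul_add, smul_smul]
      linear_combination (norm := module) (1 / 4 : ℂ) • hb • (1 : Op ι)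
    · refine IsSelfAdjoint.smul (by simp [IsSelfAdjoint]) ((IsSelfAdjoint.one _).add
        (IsSelfAdjoint.smul ?_ (hs x)))
      simp [IsSelfAdjoint]
  refine ⟨⟨fun b x => Op.nonneg_iff.1 (hproj b x).nonneg, fun x => ?_⟩, hproj⟩
  rw [sum_units_int]
  simp only [dichotomic, Units.val_one, Int.cast_one, Units.val_neg, Int.cast_neg]
  module

theorem correlator_dichotomic {ι : Type*} (K : Fin 2 → Op ι) : correlator (dichotomic K) = K := by
  funext x
  simp only [correlator, dichotomic, Units.val_one, Int.cast_one, Units.val_neg, Int.cast_neg]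
  module

section Coisometry

variable {κ : Type*} (φ φ' : Hil κ)

theorem coisometryOf_apply (f : Hil κ) :
    coisometryOf φ φ' f = inner ℂ φ f • ket 0 + inner ℂ φ' f • ket 1 := rfl

theorem coisometryOf_adjoint_ket :
    (coisometryOf φ φ').adjoint (ket 0) = φ ∧ (coisometryOf φ φ').adjoint (ket 1) = φ' := by
  constructor <;>
  · refine ext_inner_right ℂ fun f => ?_
    rw [ContinuousLinearMap.adjoint_inner_left, coisometryOf_apply, inner_add_right,
      inner_smul_right, inner_smul_right, inner_ket, inner_ket]
    simp [ket_apply]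

variable {φ φ'}

theorem coisometryOf_comp_adjoint (h : ‖φ‖ = 1) (h' : ‖φ'‖ = 1) (horth : inner ℂ φ φ' = 0) :
    coisometryOf φ φ' ∘L (coisometryOf φ φ').adjoint = 1 := by
  have horth' : inner ℂ φ' φ = 0 := inner_eq_zero_symm.1 horth
  refine op_ext_ket fun j => ?_
  rw [ContinuousLinearMap.comp_apply]
  fin_cases j
  · change coisometryOf φ φ' ((coisometryOf φ φ').adjoint (ket 0)) = ket 0
    rw [(coisometryOf_adjoint_ket φ φ').1, coisometryOf_apply, horth', inner_self_eq_norm_sq_to_K, h]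
    simp
  · change coisometryOf φ φ' ((coisometryOf φ φ').adjoint (ket 1)) = ket 1
    rw [(coisometryOf_adjoint_ket φ φ').2, coisometryOf_apply, horth, inner_self_eq_norm_sq_to_K, h']
    simp

/-- Here `a b c d` are the coefficients of `T` on `φ, φ'` and of `S` on the computational basis.
Intertwining with the adjoint records that the span of `φ, φ'` is invariant under `T`, which is more
than an equality of compressions. -/
theorem comp_coisometryOf_adjoint {T : Op κ} {S : Op (Fin 2)} {a b c d : ℂ}
    (hφ : T φ = a • φ + b • φ') (hφ' : T φ' = c • φ + d • φ')
    (h0 : S (ket 0) = a • ket 0 + b • ket 1) (h1 : S (ket 1) = c • ket 0 + d • ket 1) :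
    T ∘L (coisometryOf φ φ').adjoint = (coisometryOf φ φ').adjoint ∘L S := by
  obtain ⟨e0, e1⟩ := coisometryOf_adjoint_ket φ φ'
  refine op_ext_ket fun j => ?_
  rw [ContinuousLinearMap.comp_apply, ContinuousLinearMap.comp_apply]
  fin_cases j
  · change T ((coisometryOf φ φ').adjoint (ket 0)) = (coisometryOf φ φ').adjoint (S (ket 0))
    rw [e0, h0, hφ, map_add, map_smul, map_smul, e0, e1]
  · change T ((coisometryOf φ φ').adjoint (ket 1)) = (coisometryOf φ φ').adjoint (S (ket 1))
    rw [e1, h1, hφ', map_add, map_smul, map_smul, e0, e1]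

end Coisometry

/-- Moving `B_y` through the adjoint gives `V (1 + b B_y) V†/2 = V V† (1 + b S_y)/2 = (1 + b
S_y)/2`, a projection because `S_y² = 1`. Every family is an instance. -/
theorem givesComplex_of_intertwining {V : Type} [Fintype V] [DecidableEq V]
    {B : Fin 2 → BellFunctional V} {K : V → Fin 2 → Op (Fin 2)} {φ φ' : Hil (V → Fin 2)}
    {S : Fin 2 → Op (Fin 2)} (hB : ∀ y, BellFunctional.BoundedBy.{u} 1 (B y))
    (hKs : ∀ v x, IsSelfAdjoint (K v x)) (hKu : ∀ v x, K v x * K v x = 1)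
    (hSs : ∀ y, IsSelfAdjoint (S y)) (hSu : ∀ y, S y * S y = 1)
    (hφ : ‖φ‖ = 1) (hφ' : ‖φ'‖ = 1) (horth : inner ℂ φ φ' = 0)
    (hS : ∀ y, (B y).op K ∘L (coisometryOf φ φ').adjoint = (coisometryOf φ φ').adjoint ∘L S y) :
    GivesComplex.{u} B K φ φ' S := by
  have hco := coisometryOf_comp_adjoint hφ hφ' horth
  have hmeas : ∀ v, IsMeasurement (dichotomic (K v)) := fun v =>
    (dichotomic_isMeasurement (hKs v) (hKu v)).1
  have hren : (connectorOf B).renormalized (fun v => dichotomic (K v)) (coisometryOf φ φ')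
      = dichotomic S := by
    funext b y
    rw [ConnectorTensor.renormalized, connectorOf_apply B hmeas]
    simp only [correlator_dichotomic]
    rw [ContinuousLinearMap.smul_comp, ContinuousLinearMap.comp_smul, dichotomic,
      ContinuousLinearMap.add_comp, ContinuousLinearMap.comp_add, ContinuousLinearMap.smul_comp,
      ContinuousLinearMap.comp_smul, hS,
      ← ContinuousLinearMap.comp_assoc _ _ (S y), hco]
    congr 2
  refine ⟨hB, fun ι A hA b y => connectorOf_apply B hA b y,
    ⟨connectorOf_isConnector hB, hmeas, hco, ?_⟩, fun b y => by rw [hren]; rfl⟩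
  rw [hren]
  have h := dichotomic_isMeasurement hSs hSu
  exact ⟨h.2, h.1.2⟩

/-! ### Bounds of Bell functionals -/

section Mono

variable {V : Type} [Fintype V] [DecidableEq V] {ι : V → Type*}

theorem opLin_mono_isObservable {K : ∀ v, Fin 2 → Op (ι v)} (hK : ∀ v x, IsObservable (K v x))
    (s : V → Option (Fin 2)) : IsObservable (opLin K (mono s)) := by
  have h : ∀ v, IsObservable ((s v).elim 1 (K v)) := fun v => by
    cases s v with
    | none => exact ⟨.one _, ContinuousLinearMap.norm_id_le⟩
    | some x => exact hK v x
  rw [opLin_mono]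
  exact ⟨tensorOp_isSelfAdjoint fun v => (h v).1, norm_tensorOp_le_one fun v => (h v).2⟩

theorem opLin_mono_mul (K : ∀ v, Fin 2 → Op (ι v)) {s t r : V → Option (Fin 2)}
    (h : ∀ v, (s v = none ∧ r v = t v) ∨ (t v = none ∧ r v = s v)) :
    opLin K (mono s) * opLin K (mono t) = opLin K (mono r) := by
  rw [opLin_mono, opLin_mono, opLin_mono, tensorOp_mul]
  congr 1
  funext v
  rcases h v with ⟨h1, h2⟩ | ⟨h1, h2⟩ <;> simp [h1, h2]

theorem opLin_mono_commute (K : ∀ v, Fin 2 → Op (ι v)) {s t : V → Option (Fin 2)}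
    (h : ∀ v, s v = none ∨ t v = none) : Commute (opLin K (mono s)) (opLin K (mono t)) := by
  change opLin K (mono s) * opLin K (mono t) = opLin K (mono t) * opLin K (mono s)
  rw [opLin_mono_mul K (r := fun v => (s v).or (t v)), opLin_mono_mul K (r := fun v => (s v).or (t v))]
  · intro v
    rcases h v with h | h <;> simp [h]
  · intro v
    rcases h v with h | h <;> simp [h]

theorem boundedBy_iff {c : ℝ} {B : BellFunctional V} :
    BellFunctional.BoundedBy.{u} c B ↔
      ∀ (ι : V → Type u) (A : ∀ v, ℤˣ → Fin 2 → Op (ι v)), (∀ v, IsMeasurement (A v)) →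
        0 ≤ (c : ℂ) • 1 - opLin (fun v => correlator (A v)) B ∧
        0 ≤ (c : ℂ) • 1 + opLin (fun v => correlator (A v)) B := by
  simp only [Op.nonneg_iff]
  rfl

/-- Contractivity of the correlators is all that the bounds use, so the POVMs can be forgotten. -/
theorem boundedBy_of_observable {c : ℝ} {B : BellFunctional V}
    (h : ∀ (ι : V → Type u) (K : ∀ v, Fin 2 → Op (ι v)), (∀ v x, IsObservable (K v x)) →
        0 ≤ (c : ℂ) • 1 - opLin K B ∧ 0 ≤ (c : ℂ) • 1 + opLin K B) :
    BellFunctional.BoundedBy.{u} c B :=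
  boundedBy_iff.2 fun ι _ hA => h ι _ fun v x => correlator_isObservable (hA v) x

theorem boundedBy_mono (s : V → Option (Fin 2)) : BellFunctional.BoundedBy.{u} 1 (mono s) :=
  boundedBy_of_observable fun ι K hK => by
    have h := opLin_mono_isObservable hK s
    simpa using And.intro h.one_sub_nonneg h.one_add_nonneg

theorem BoundedBy.add {c c' : ℝ} {B B' : BellFunctional V} (h : BellFunctional.BoundedBy.{u} c B)
    (h' : BellFunctional.BoundedBy.{u} c' B') : BellFunctional.BoundedBy.{u} (c + c') (B + B') := by
  rw [boundedBy_iff] at *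
  intro ι A hA
  obtain ⟨h1, h2⟩ := h ι A hA
  obtain ⟨h3, h4⟩ := h' ι A hA
  refine ⟨?_, ?_⟩
  · convert add_nonneg h1 h3 using 1
    rw [map_add, Complex.ofReal_add, add_smul]
    abel
  · convert add_nonneg h2 h4 using 1
    rw [map_add, Complex.ofReal_add, add_smul]
    abel

theorem BoundedBy.sum {I : Type*} (s : Finset I) {c : ℝ} {B : I → BellFunctional V}
    (h : ∀ i ∈ s, BellFunctional.BoundedBy.{u} c (B i)) :
    BellFunctional.BoundedBy.{u} (s.card * c) (∑ i ∈ s, B i) := by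
  classical
  induction s using Finset.induction_on with
  | empty =>
    rw [boundedBy_iff]
    intro ι A hA
    simp
  | insert k s hk ih =>
    rw [Finset.sum_insert hk, Finset.card_insert_of_notMem hk]
    have := BoundedBy.add (h k (by simp)) (ih fun i hi => h i (by simp [hi]))
    convert this using 1
    push_cast
    ring

theorem BoundedBy.smul {c : ℝ} (hc : 0 < c) {B : BellFunctional V}
    (h : BellFunctional.BoundedBy.{u} c B) : BellFunctional.BoundedBy.{u} 1 ((1 / c) • B) := by
  rw [boundedBy_iff] at *
  intro ι A hA
  obtain ⟨h1, h2⟩ := h ι A hA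
  have e : ((1 : ℝ) : ℂ) • (1 : Op (∀ v, ι v)) = ((1 / c : ℝ) : ℂ) • (c : ℂ) • 1 := by
    rw [smul_smul, ← Complex.ofReal_mul, one_div_mul_cancel hc.ne']
  rw [opLin_smul, e, ← smul_sub, ← smul_add]
  exact ⟨ofReal_smul_nonneg (by positivity) h1, ofReal_smul_nonneg (by positivity) h2⟩

end Mono

/-! ### Two-party functionals and the tilted CHSH bound -/

section TwoParty

variable {ι : Fin 2 → Type*} (K : ∀ v, Fin 2 → Op (ι v))

/-- `1 ⊗ K^{(2)}_y`. -/
def corSnd (y : Fin 2) : BellFunctional (Fin 2) := mono ![none, some y]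

theorem opLin_cor (x y : Fin 2) :
    opLin K (cor x y) = opLin K (corFst x) * opLin K (corSnd y) := by
  rw [cor, corFst, corSnd, opLin_mono_mul]
  intro v
  fin_cases v <;> simp

theorem commute_corFst_corSnd (x y : Fin 2) :
    Commute (opLin K (corFst x)) (opLin K (corSnd y)) := by
  rw [corFst, corSnd]
  refine opLin_mono_commute K fun v => ?_
  fin_cases v <;> simp

end TwoParty

theorem boundedBy_tilted {α β : ℝ} (hβ : 0 < β) (hαβ : β ^ 2 = 8 + 2 * α ^ 2) :
    BellFunctional.BoundedBy.{u} β
      (α • corFst 0 + cor 0 0 + cor 1 0 + cor 0 1 - cor 1 1) ∧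
    BellFunctional.BoundedBy.{u} β
      (α • corFst 1 - cor 0 0 + cor 1 0 + cor 0 1 + cor 1 1) := by
  constructor <;> refine boundedBy_of_observable fun ι K hK => ?_
  all_goals
    have ha : ∀ x, IsObservable (opLin K (corFst x)) := fun x => opLin_mono_isObservable hK _
    have hb : ∀ y, IsObservable (opLin K (corSnd y)) := fun y => opLin_mono_isObservable hK _
    have hc := commute_corFst_corSnd K
    simp only [map_add, map_sub, opLin_smul, opLin_cor]
  · exact tilted_bound hβ hαβ (ha 0) (ha 1) (hb 0) (hb 1) (hc 0 0) (hc 0 1) (hc 1 0) (hc 1 1)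
  -- The second functional is the first after `a₀ ↦ a₁`, `a₁ ↦ -a₀`.
  · convert tilted_bound hβ hαβ (ha 1) (ha 0).neg (hb 0) (hb 1) (hc 1 0) (hc 1 1) (hc 0 0).neg_left
      (hc 0 1).neg_left using 3
    all_goals
      simp only [neg_mul]
      abel

/-! ### Matrix elements of qubit operators -/

theorem matOp_ket {n : Type*} [Fintype n] [DecidableEq n] (M : Matrix n n ℂ) (i j : n) :
    (matOp M (ket j)) i = M i j := by
  change (M.mulVec fun k => (ket j) k) i = M i j
  simp [Matrix.mulVec, dotProduct, ket_apply]

theorem matOp_mul {n : Type*} [Fintype n] [DecidableEq n] (M N : Matrix n n ℂ) :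
    matOp M * matOp N = matOp (M * N) := by
  refine op_ext_entries fun i j => ?_
  rw [matOp_ket]
  change (M.mulVec fun k => (matOp N (ket j)) k) i = _
  simp only [matOp_ket]
  rfl

theorem matOp_one {n : Type*} [Fintype n] [DecidableEq n] : matOp (1 : Matrix n n ℂ) = 1 := by
  refine op_ext_entries fun i j => ?_
  rw [matOp_ket, one_apply_eq_self, ket_apply, Matrix.one_apply]

theorem matOp_star {n : Type*} [Fintype n] [DecidableEq n] (M : Matrix n n ℂ) :
    star (matOp M) = matOp M.conjTranspose := by
  refine op_ext_entries fun i j => ?_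
  rw [ContinuousLinearMap.star_eq_adjoint, adjoint_entry, matOp_ket, matOp_ket]
  rfl

/-- Combinations of two anticommuting Hermitian unitary matrices. -/
theorem reflection_of_anticommute {ι : Type*} {S T : Op ι} (hS : IsSelfAdjoint S)
    (hT : IsSelfAdjoint T) (hS2 : S * S = 1) (hT2 : T * T = 1) (hST : S * T + T * S = 0)
    {a b : ℝ} (hab : a ^ 2 + b ^ 2 = 1) :
    IsSelfAdjoint ((a : ℂ) • S + (b : ℂ) • T) ∧
      ((a : ℂ) • S + (b : ℂ) • T) * ((a : ℂ) • S + (b : ℂ) • T) = 1 := by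
  refine ⟨(IsSelfAdjoint.smul (Complex.conj_ofReal a) hS).add
    (IsSelfAdjoint.smul (Complex.conj_ofReal b) hT), ?_⟩
  have hab' : (a : ℂ) ^ 2 + (b : ℂ) ^ 2 = 1 := by exact_mod_cast hab
  simp only [add_mul, mul_add, smul_mul_assoc, mul_smul_comm, hS2, hT2]
  linear_combination (norm := module) hab' • (1 : Op ι) + ((a : ℂ) * b) • hST

theorem σX_isSelfAdjoint : IsSelfAdjoint σX := by
  rw [isSelfAdjoint_iff, σX, matOp_star]
  congr 1
  ext i j
  fin_cases i <;> fin_cases j <;> simp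

theorem σY_isSelfAdjoint : IsSelfAdjoint σY := by
  rw [isSelfAdjoint_iff, σY, matOp_star]
  congr 1
  ext i j
  fin_cases i <;> fin_cases j <;> simp

theorem σZ_isSelfAdjoint : IsSelfAdjoint σZ := by
  rw [isSelfAdjoint_iff, σZ, matOp_star]
  congr 1
  ext i j
  fin_cases i <;> fin_cases j <;> simp

theorem σX_mul_self : σX * σX = 1 := by
  rw [σX, matOp_mul, ← matOp_one, Matrix.one_fin_two]
  simp

theorem σY_mul_self : σY * σY = 1 := by
  rw [σY, matOp_mul, ← matOp_one, Matrix.one_fin_two]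
  simp

theorem σZ_mul_self : σZ * σZ = 1 := by
  rw [σZ, matOp_mul, ← matOp_one, Matrix.one_fin_two]
  simp

theorem σX_mul_σZ : σX * σZ = -(σZ * σX) := by
  rw [σX, σZ, matOp_mul, matOp_mul]
  refine op_ext_entries fun i j => ?_
  change _ = -(matOp _ (ket j)) i
  rw [matOp_ket, matOp_ket]
  fin_cases i <;> fin_cases j <;> simp

theorem σX_mul_σY : σX * σY = -(σY * σX) := by
  rw [σX, σY, matOp_mul, matOp_mul]
  refine op_ext_entries fun i j => ?_
  change _ = -(matOp _ (ket j)) i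
  rw [matOp_ket, matOp_ket]
  fin_cases i <;> fin_cases j <;> simp

theorem σY_mul_σZ : σY * σZ = -(σZ * σY) := by
  rw [σY, σZ, matOp_mul, matOp_mul]
  refine op_ext_entries fun i j => ?_
  change _ = -(matOp _ (ket j)) i
  rw [matOp_ket, matOp_ket]
  fin_cases i <;> fin_cases j <;> simp

theorem σX_ket_zero : σX (ket 0) = ket 1 := by
  ext i
  rw [σX, matOp_ket, ket_apply]
  fin_cases i <;> simp

theorem σX_ket_one : σX (ket 1) = ket 0 := by
  ext i
  rw [σX, matOp_ket, ket_apply]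
  fin_cases i <;> simp

theorem σY_ket_zero : σY (ket 0) = Complex.I • ket 1 := by
  ext i
  change _ = Complex.I * (ket 1) i
  rw [σY, matOp_ket, ket_apply]
  fin_cases i <;> simp

theorem σY_ket_one : σY (ket 1) = -Complex.I • ket 0 := by
  ext i
  change _ = -Complex.I * (ket 0) i
  rw [σY, matOp_ket, ket_apply]
  fin_cases i <;> simp

theorem σZ_ket_zero : σZ (ket 0) = ket 0 := by
  ext i
  rw [σZ, matOp_ket, ket_apply]
  fin_cases i <;> simp

theorem σZ_ket_one : σZ (ket 1) = -ket 1 := by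
  ext i
  change _ = -(ket 1) i
  rw [σZ, matOp_ket, ket_apply]
  fin_cases i <;> simp

theorem norm_eq_one_of_inner {ι : Type*} {φ : Hil ι} (h : inner ℂ φ φ = 1) : ‖φ‖ = 1 := by
  rw [inner_self_eq_norm_sq_to_K] at h
  have h' : ‖φ‖ ^ 2 = 1 := Complex.ofReal_injective (by simpa using h)
  exact (pow_eq_one_iff_of_nonneg (norm_nonneg _) two_ne_zero).1 h'

/-- Two-qubit product operators in the computational basis. -/
theorem tensorOp_two (A : Fin 2 → Op (Fin 2)) (j k : Fin 2) {a b c d : ℂ}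
    (h0 : A 0 (ket j) = a • ket 0 + b • ket 1) (h1 : A 1 (ket k) = c • ket 0 + d • ket 1) :
    tensorOp A (ket ![j, k]) = (a * c) • ket ![0, 0] + (a * d) • ket ![0, 1]
      + (b * c) • ket ![1, 0] + (b * d) • ket ![1, 1] := by
  ext i
  rw [tensorOp_ket, Fin.prod_univ_two]
  change (A 0 (ket j)) (i 0) * (A 1 (ket k)) (i 1) = a * c * (ket ![0, 0]) i +
    a * d * (ket ![0, 1]) i + b * c * (ket ![1, 0]) i + b * d * (ket ![1, 1]) i
  obtain ⟨p, q, rfl⟩ : ∃ p q, i = ![p, q] := ⟨i 0, i 1, by ext v; fin_cases v <;> rfl⟩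
  rw [h0, h1]
  change (a * (ket 0) p + b * (ket 1) p) * (c * (ket 0) q + d * (ket 1) q) = _
  simp only [ket_apply]
  fin_cases p <;> fin_cases q <;> simp

/-! ### Tilted CHSH -/

section RealPlane

theorem realPlane_ket_zero (z w : ℂ) : (z • σZ + w • σX) (ket 0) = z • ket 0 + w • ket 1 := by
  change z • σZ (ket 0) + w • σX (ket 0) = _
  rw [σZ_ket_zero, σX_ket_zero]

theorem realPlane_ket_one (z w : ℂ) : (z • σZ + w • σX) (ket 1) = w • ket 0 + (-z) • ket 1 := by
  change z • σZ (ket 1) + w • σX (ket 1) = _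
  rw [σZ_ket_one, σX_ket_one]
  module

variable {K : Fin 2 → Fin 2 → Op (Fin 2)} {z w : Fin 2 → Fin 2 → ℂ}

theorem opLin_cor_ket_of_realPlane (hK : ∀ v x, K v x = z v x • σZ + w v x • σX) (x y : Fin 2) :
    opLin K (cor x y) (ket ![0, 0]) = (z 0 x * z 1 y) • ket ![0, 0] + (z 0 x * w 1 y) • ket ![0, 1]
      + (w 0 x * z 1 y) • ket ![1, 0] + (w 0 x * w 1 y) • ket ![1, 1] ∧
    opLin K (cor x y) (ket ![0, 1]) = (z 0 x * w 1 y) • ket ![0, 0] + (z 0 x * -z 1 y) • ket ![0, 1]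
      + (w 0 x * w 1 y) • ket ![1, 0] + (w 0 x * -z 1 y) • ket ![1, 1] ∧
    opLin K (cor x y) (ket ![1, 0]) = (w 0 x * z 1 y) • ket ![0, 0] + (w 0 x * w 1 y) • ket ![0, 1]
      + (-z 0 x * z 1 y) • ket ![1, 0] + (-z 0 x * w 1 y) • ket ![1, 1] ∧
    opLin K (cor x y) (ket ![1, 1]) = (w 0 x * w 1 y) • ket ![0, 0] + (w 0 x * -z 1 y) • ket ![0, 1]
      + (-z 0 x * w 1 y) • ket ![1, 0] + (-z 0 x * -z 1 y) • ket ![1, 1] := by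
  have h0 : ∀ v x, K v x (ket 0) = z v x • ket 0 + w v x • ket 1 := fun v x => by
    rw [hK, realPlane_ket_zero]
  have h1 : ∀ v x, K v x (ket 1) = w v x • ket 0 + (-z v x) • ket 1 := fun v x => by
    rw [hK, realPlane_ket_one]
  rw [cor, opLin_mono]
  exact ⟨tensorOp_two _ 0 0 (h0 0 x) (h0 1 y), tensorOp_two _ 0 1 (h0 0 x) (h1 1 y),
    tensorOp_two _ 1 0 (h1 0 x) (h0 1 y), tensorOp_two _ 1 1 (h1 0 x) (h1 1 y)⟩

theorem opLin_corFst_ket_of_realPlane (hK : ∀ v x, K v x = z v x • σZ + w v x • σX) (x : Fin 2) :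
    opLin K (corFst x) (ket ![0, 0]) = z 0 x • ket ![0, 0] + w 0 x • ket ![1, 0] ∧
    opLin K (corFst x) (ket ![0, 1]) = z 0 x • ket ![0, 1] + w 0 x • ket ![1, 1] ∧
    opLin K (corFst x) (ket ![1, 0]) = w 0 x • ket ![0, 0] + (-z 0 x) • ket ![1, 0] ∧
    opLin K (corFst x) (ket ![1, 1]) = w 0 x • ket ![0, 1] + (-z 0 x) • ket ![1, 1] := by
  have h0 : K 0 x (ket 0) = z 0 x • ket 0 + w 0 x • ket 1 := by
    rw [hK, realPlane_ket_zero]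
  have h1 : K 0 x (ket 1) = w 0 x • ket 0 + (-z 0 x) • ket 1 := by
    rw [hK, realPlane_ket_one]
  have i0 : (1 : Op (Fin 2)) (ket 0) = (1 : ℂ) • ket 0 + (0 : ℂ) • ket 1 := by simp
  have i1 : (1 : Op (Fin 2)) (ket 1) = (0 : ℂ) • ket 0 + (1 : ℂ) • ket 1 := by simp
  rw [corFst, opLin_mono]
  refine ⟨(tensorOp_two _ 0 0 h0 i0).trans ?_, (tensorOp_two _ 0 1 h0 i1).trans ?_,
    (tensorOp_two _ 1 0 h1 i0).trans ?_, (tensorOp_two _ 1 1 h1 i1).trans ?_⟩ <;> module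

end RealPlane

theorem inner_ket_ket {ι : Type*} [DecidableEq ι] (i j : ι) :
    inner ℂ (ket i) (ket j) = if i = j then (1 : ℂ) else 0 := by
  rw [inner_ket, ket_apply]

namespace Tilted

/-- With `r = √(1 + sin² 2θ)` one has `α = 2 cos 2θ / r`, `β = 4 / r`, `cos μ = 1 / r` and `sin μ =
sin 2θ / r`. Expressing everything through `β` removes the nested roots from the eigenvalue
equations. -/
theorem params (θ : ℝ) : 0 < β θ ∧ α θ = Real.cos (2 * θ) * β θ / 2 ∧
    Real.cos (μ θ) = β θ / 4 ∧ Real.sin (μ θ) = Real.sin (2 * θ) * β θ / 4 ∧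
    β θ ^ 2 = 8 + 2 * α θ ^ 2 := by
  set c := Real.cos (2 * θ) with hc
  set s := Real.sin (2 * θ) with hs
  have hsc : s ^ 2 + c ^ 2 = 1 := Real.sin_sq_add_cos_sq _
  set r := √(1 + s ^ 2) with hr
  have hr0 : 0 < r := Real.sqrt_pos.2 (by positivity)
  have hr2 : r ^ 2 = 1 + s ^ 2 := Real.sq_sqrt (by positivity)
  have hα : α θ = 2 * c / r := by
    rw [α, ← hc]
    -- At `c = 0` the factor `Real.sign 0 = 0` gives `α = 0`, whatever default value the tangent
    -- takes there.
    rcases eq_or_ne c 0 with h0 | h0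
    · simp [h0]
    · have h1 : 1 + 2 * Real.tan (2 * θ) ^ 2 = (r / c) ^ 2 := by
        rw [Real.tan_eq_sin_div_cos, ← hc, ← hs, div_pow, div_pow, hr2]
        field_simp
        linarith
      -- The root is `r / |c|`; the sign factor in `α` turns `|c|` back into `c`.
      rw [h1, Real.sqrt_sq_eq_abs, abs_div, abs_of_pos hr0]
      rcases lt_or_gt_of_ne h0 with h | h
      · rw [Real.sign_of_neg h, abs_of_neg h]
        field_simp
      · rw [Real.sign_of_pos h, abs_of_pos h]
        field_simp
  have hβ : β θ = 4 / r := by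
    rw [β, hα, show 8 + 2 * (2 * c / r) ^ 2 = (4 / r) ^ 2 by
      rw [div_pow, div_pow, hr2]
      field_simp
      linear_combination 8 * hsc, Real.sqrt_sq (by positivity)]
  refine ⟨by rw [hβ]; positivity, ?_, ?_, ?_, ?_⟩
  · rw [hα, hβ]
    ring
  · rw [μ, Real.cos_arctan, ← hs, ← hr, hβ]
    field_simp
  · rw [μ, Real.sin_arctan, ← hs, ← hr, hβ]
    field_simp
  · rw [β, Real.sq_sqrt (by positivity)]

theorem K_eq (θ : ℝ) (v x : Fin 2) : K θ v x =
    ((![![1, 0], ![Real.cos (μ θ), Real.cos (μ θ)]] v x : ℝ) : ℂ) • σZ +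
    ((![![0, 1], ![Real.sin (μ θ), -Real.sin (μ θ)]] v x : ℝ) : ℂ) • σX := by
  fin_cases v <;> fin_cases x <;> simp [K, -Complex.coe_smul, sub_eq_add_neg]

theorem K_isReflection (θ : ℝ) (v x : Fin 2) :
    IsSelfAdjoint (K θ v x) ∧ K θ v x * K θ v x = 1 := by
  rw [K_eq]
  refine reflection_of_anticommute σZ_isSelfAdjoint σX_isSelfAdjoint σZ_mul_self σX_mul_self
    (by rw [σX_mul_σZ, add_neg_cancel]) ?_
  fin_cases v <;> fin_cases x <;> simp

theorem eigen (θ : ℝ) :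
    (B θ 1).op (K θ) (φp θ) = φp θ ∧ (B θ 1).op (K θ) (φm θ) = -φm θ ∧
      (B θ 0).op (K θ) (φp θ) = φm θ ∧ (B θ 0).op (K θ) (φm θ) = φp θ := by
  obtain ⟨hβ, hα, hc, hs, -⟩ := params θ
  rw [Real.cos_two_mul] at hα
  rw [Real.sin_two_mul] at hs
  have hβ' : (β θ : ℂ) ≠ 0 := by exact_mod_cast hβ.ne'
  have hsc : (Real.sin θ : ℂ) ^ 2 + (Real.cos θ : ℂ) ^ 2 = 1 := by
    exact_mod_cast Real.sin_sq_add_cos_sq θ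
  have h1 := opLin_corFst_ket_of_realPlane (K_eq θ)
  have h2 := opLin_cor_ket_of_realPlane (K_eq θ)
  have e1 : (B θ 1).op (K θ) = _ := (opLin_apply _ _).symm.trans (opLin_smul (K θ) (1 / β θ) _)
  have e0 : (B θ 0).op (K θ) = _ := (opLin_apply _ _).symm.trans (opLin_smul (K θ) (1 / β θ) _)
  rw [e1, e0]
  simp only [map_add, map_sub, opLin_smul, φp, φm]
  simp only [map_smul, add_apply, sub_apply, smul_apply, h1, h2]
  simp only [Matrix.cons_val_zero, Matrix.cons_val_one, hα, hc, hs, Complex.ofReal_mul,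
    Complex.ofReal_div, Complex.ofReal_sub, Complex.ofReal_pow, Complex.ofReal_neg,
    Complex.ofReal_one, Complex.ofReal_zero, Complex.ofReal_ofNat]
  -- From here on only `s² + c² = 1` and `b ≠ 0` matter.
  generalize (Real.sin θ : ℂ) = s at *
  generalize (Real.cos θ : ℂ) = c at *
  generalize (β θ : ℂ) = b at *
  refine ⟨?_, ?_, ?_, ?_⟩ <;> match_scalars <;> field_simp
  all_goals first
    | ring1
    | linear_combination 8 * c * hsc
    | linear_combination -8 * c * hsc

theorem orthonormal (θ : ℝ) : ‖φp θ‖ = 1 ∧ ‖φm θ‖ = 1 ∧ inner ℂ (φp θ) (φm θ) = 0 := by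
  have hsc : (Real.sin θ : ℂ) ^ 2 + (Real.cos θ : ℂ) ^ 2 = 1 := by
    exact_mod_cast Real.sin_sq_add_cos_sq θ
  have ne : (![0, 0] : Fin 2 → Fin 2) ≠ ![1, 1] ∧ (![1, 1] : Fin 2 → Fin 2) ≠ ![0, 0] ∧
      (![1, 0] : Fin 2 → Fin 2) ≠ ![0, 1] ∧ (![0, 1] : Fin 2 → Fin 2) ≠ ![1, 0] ∧
      (![0, 0] : Fin 2 → Fin 2) ≠ ![1, 0] ∧ (![0, 0] : Fin 2 → Fin 2) ≠ ![0, 1] ∧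
      (![1, 1] : Fin 2 → Fin 2) ≠ ![1, 0] ∧ (![1, 1] : Fin 2 → Fin 2) ≠ ![0, 1] := by decide
  obtain ⟨n1, n2, n3, n4, n5, n6, n7, n8⟩ := ne
  refine ⟨norm_eq_one_of_inner ?_, norm_eq_one_of_inner ?_, ?_⟩ <;>
  simp only [φp, φm, inner_add_left, inner_add_right, inner_sub_left, inner_sub_right,
    inner_smul_left, inner_smul_right, inner_ket_ket, Complex.conj_ofReal, if_true, if_neg n1,
    if_neg n2, if_neg n3, if_neg n4, if_neg n5, if_neg n6, if_neg n7, if_neg n8]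
  · linear_combination hsc
  · linear_combination hsc
  · ring

theorem givesComplex (θ : ℝ) : GivesComplex.{u} (B θ) (K θ) (φp θ) (φm θ) ![σX, σZ] := by
  obtain ⟨hβ, -, -, -, hαβ⟩ := params θ
  obtain ⟨h1, h2, h3, h4⟩ := eigen θ
  obtain ⟨hp, hm, horth⟩ := orthonormal θ
  obtain ⟨b1, b0⟩ := boundedBy_tilted.{u} hβ hαβ
  refine givesComplex_of_intertwining ?_ (fun v x => (K_isReflection θ v x).1)
    (fun v x => (K_isReflection θ v x).2) ?_ ?_ hp hm horth ?_ <;> intro y <;> fin_cases y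
  · exact BoundedBy.smul hβ b0
  · exact BoundedBy.smul hβ b1
  · exact σX_isSelfAdjoint
  · exact σZ_isSelfAdjoint
  · exact σX_mul_self
  · exact σZ_mul_self
  · refine comp_coisometryOf_adjoint (a := 0) (b := 1) (c := 1) (d := 0) (h3.trans ?_)
      (h4.trans ?_) (σX_ket_zero.trans ?_) (σX_ket_one.trans ?_) <;> module
  · refine comp_coisometryOf_adjoint (a := 1) (b := 0) (c := 0) (d := -1) (h1.trans ?_)
      (h2.trans ?_) (σZ_ket_zero.trans ?_) (σZ_ket_one.trans ?_) <;> module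

end Tilted

/-- At `θ = π/4` one has `cos 2θ = 0` and `sin 2θ = 1`, hence `α = 0`, `β = 2√2` and `cos μ = sin μ
= 1/√2`. -/
theorem CHSH.eq_tilted : CHSH.B = Tilted.B (Real.pi / 4) ∧ CHSH.K = Tilted.K (Real.pi / 4) ∧
    CHSH.φp = Tilted.φp (Real.pi / 4) ∧ CHSH.φm = Tilted.φm (Real.pi / 4) := by
  obtain ⟨hβ, hα, hc, hs, hαβ⟩ := Tilted.params (Real.pi / 4)
  rw [show 2 * (Real.pi / 4) = Real.pi / 2 by ring] at hα hs
  rw [Real.cos_pi_div_two, zero_mul, zero_div] at hα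
  rw [hα] at hαβ
  have h2 : √2 ^ 2 = 2 := Real.sq_sqrt (by norm_num)
  have h20 : 0 < √2 := Real.sqrt_pos.2 (by norm_num)
  have hβ' : Tilted.β (Real.pi / 4) = 2 * √2 := by
    refine (pow_left_inj₀ hβ.le (by positivity) two_ne_zero).1 ?_
    rw [hαβ, mul_pow, h2]
    norm_num
  have e : √2 / 2 = 1 / √2 := by
    field_simp
    exact h2
  have e' : 2 * √2 / 4 = 1 / √2 := by
    rw [← e]
    ring
  rw [hβ', e'] at hc
  rw [hβ', Real.sin_pi_div_two, one_mul, e'] at hs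
  refine ⟨?_, ?_, ?_, ?_⟩
  · rw [CHSH.B, Tilted.B, hα, hβ', zero_smul, zero_smul, zero_sub, zero_add]
  · rw [CHSH.K, Tilted.K, hc, hs, smul_add, smul_sub]
  · rw [CHSH.φp, Tilted.φp, Real.cos_pi_div_four, Real.sin_pi_div_four, e, smul_add]
  · rw [CHSH.φm, Tilted.φm, Real.cos_pi_div_four, Real.sin_pi_div_four, e, smul_sub]

/-! ### The WBC family: equatorial observables on a maximally entangled pair -/

namespace WBC

theorem equatorial_zero : equatorial 0 = σX := by
  simp [equatorial]

theorem equatorial_isReflection (t : ℝ) :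
    IsSelfAdjoint (equatorial t) ∧ equatorial t * equatorial t = 1 :=
  reflection_of_anticommute σX_isSelfAdjoint σY_isSelfAdjoint σX_mul_self σY_mul_self
    (by rw [σX_mul_σY, neg_add_cancel]) (Real.cos_sq_add_sin_sq t)

theorem equatorial_ket_zero (t : ℝ) : equatorial t (ket 0) =
    (0 : ℂ) • ket 0 + ((Real.cos t : ℂ) + Complex.I * Real.sin t) • ket 1 := by
  change (Real.cos t : ℂ) • σX (ket 0) + (Real.sin t : ℂ) • σY (ket 0) = _
  rw [σX_ket_zero, σY_ket_zero]
  module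

theorem equatorial_ket_one (t : ℝ) : equatorial t (ket 1) =
    ((Real.cos t : ℂ) - Complex.I * Real.sin t) • ket 0 + (0 : ℂ) • ket 1 := by
  change (Real.cos t : ℂ) • σX (ket 1) + (Real.sin t : ℂ) • σY (ket 1) = _
  rw [σX_ket_one, σY_ket_one]
  module

/-- Each equatorial observable flips its qubit with a phase `e^{±it}`. The two phases multiply, so
only `s + t` survives and the span of `|00⟩, |11⟩` is invariant. -/
theorem opLin_cor_ket {K : Fin 2 → Fin 2 → Op (Fin 2)} {x y : Fin 2} {s t : ℝ}
    (hx : K 0 x = equatorial s) (hy : K 1 y = equatorial t) :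
    opLin K (cor x y) (ket ![0, 0])
      = ((Real.cos (s + t) : ℂ) + Complex.I * Real.sin (s + t)) • ket ![1, 1] ∧
    opLin K (cor x y) (ket ![1, 1])
      = ((Real.cos (s + t) : ℂ) - Complex.I * Real.sin (s + t)) • ket ![0, 0] := by
  rw [cor, opLin_mono]
  have x0 := equatorial_ket_zero s
  have x1 := equatorial_ket_one s
  have y0 := equatorial_ket_zero t
  have y1 := equatorial_ket_one t
  rw [← hx] at x0 x1
  rw [← hy] at y0 y1
  have hc : (Real.cos (s + t) : ℂ) = Real.cos s * Real.cos t - Real.sin s * Real.sin t := by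
    rw [Real.cos_add]; push_cast; rfl
  have hs : (Real.sin (s + t) : ℂ) = Real.sin s * Real.cos t + Real.cos s * Real.sin t := by
    rw [Real.sin_add]; push_cast; rfl
  have hI := Complex.I_mul_I
  refine ⟨(tensorOp_two _ 0 0 x0 y0).trans ?_, (tensorOp_two _ 1 1 x1 y1).trans ?_⟩ <;>
    rw [hc, hs]
  · linear_combination (norm := module)
      (((Real.sin s : ℂ) * Real.sin t) * hI) • ket (![1, 1] : Fin 2 → Fin 2)
  · linear_combination (norm := module)
      (((Real.sin s : ℂ) * Real.sin t) * hI) • ket (![0, 0] : Fin 2 → Fin 2)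

section Trig

variable (θ φ ω : ℝ)

/-- This and the next four identities relate the cosine coefficients of the functional to the sine
factors of `β`. The bound uses the first three as polynomial relations; the eigenvalue equations use
this one, `cos_mul_cos_sub_snd` and the last two. -/
theorem cos_mul_cos_sub_fst : Real.cos φ * Real.cos ω - Real.cos (θ + φ) * Real.cos (θ + ω) =
    Real.sin θ * Real.sin (θ + φ + ω) := by
  have h := Real.sin_sq_add_cos_sq θ
  rw [Real.sin_add (θ + φ), Real.sin_add θ φ, Real.cos_add θ φ, Real.cos_add θ ω]
  linear_combination (-Real.cos φ * Real.cos ω) * h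

theorem cos_mul_cos_sub_cross : Real.cos (θ + φ) * Real.cos ω - Real.cos φ * Real.cos (θ + ω) =
    Real.sin θ * Real.sin (ω - φ) := by
  rw [Real.sin_sub, Real.cos_add, Real.cos_add]
  ring

theorem cos_mul_cos_sub_snd : Real.cos (θ + φ) * Real.cos φ - Real.cos (θ + ω) * Real.cos ω =
    Real.sin (ω - φ) * Real.sin (θ + φ + ω) := by
  have h := Real.sin_sq_add_cos_sq φ
  have h' := Real.sin_sq_add_cos_sq ω
  rw [Real.sin_sub, Real.sin_add (θ + φ), Real.sin_add θ φ, Real.cos_add θ φ, Real.cos_add θ ω]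
  linear_combination (Real.cos θ * Real.cos ω ^ 2 - Real.sin θ * Real.cos ω * Real.sin ω) * h
    + (Real.cos φ * Real.sin θ * Real.sin φ - Real.cos θ * Real.cos φ ^ 2) * h'

theorem sin_mul_cos_sub_fst : Real.cos ω * Real.sin (θ + ω) - Real.cos φ * Real.sin (θ + φ) =
    Real.cos (θ + φ + ω) * Real.sin (ω - φ) := by
  have h := Real.sin_sq_add_cos_sq φ
  have h' := Real.sin_sq_add_cos_sq ω
  rw [Real.sin_sub, Real.cos_add (θ + φ), Real.sin_add θ φ, Real.cos_add θ φ, Real.sin_add θ ω]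
  linear_combination
    (-Real.cos θ * Real.sin ω * Real.cos ω - Real.sin θ * Real.cos ω ^ 2) * h +
    (Real.cos θ * Real.sin φ * Real.cos φ + Real.sin θ * Real.cos φ ^ 2) * h'

theorem sin_mul_cos_sub_snd : Real.cos (θ + φ) * Real.sin φ - Real.cos (θ + ω) * Real.sin ω =
    -(Real.cos (θ + φ + ω) * Real.sin (ω - φ)) := by
  have h := Real.sin_sq_add_cos_sq φ
  have h' := Real.sin_sq_add_cos_sq ω
  rw [Real.sin_sub, Real.cos_add (θ + φ), Real.sin_add θ φ, Real.cos_add θ φ, Real.cos_add θ ω]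
  linear_combination
    (Real.cos θ * Real.sin ω * Real.cos ω - Real.sin θ * Real.sin ω ^ 2) * h +
    (-Real.cos θ * Real.sin φ * Real.cos φ + Real.sin θ * Real.sin φ ^ 2) * h'

end Trig

theorem swapSettings_cor (x y : Fin 2) :
    swapSettings (cor x y) = cor (Equiv.swap 0 1 x) (Equiv.swap 0 1 y) := by
  funext s
  simp only [swapSettings, cor, mono, Pi.single_apply]
  congr 1
  simp only [eq_iff_iff, funext_iff, Fin.forall_fin_two, Matrix.cons_val_zero, Matrix.cons_val_one]
  have h : ∀ (o : Option (Fin 2)) (x : Fin 2),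
      o.map (Equiv.swap 0 1) = some x ↔ o = some (Equiv.swap 0 1 x) := by decide
  rw [h, h]

/-- `c₀₀ K₀ ⊗ L₀ + c₀₁ K₀ ⊗ L₁ + c₁₀ K₁ ⊗ L₀ + c₁₁ K₁ ⊗ L₁` with the settings relabelled by `p`. -/
noncomputable def combo (θ φ ω : ℝ) (p : Equiv.Perm (Fin 2)) : BellFunctional (Fin 2) :=
  (1 / β θ φ ω) •
    ((Real.cos (θ + φ) * Real.cos (θ + ω)) •
      (Real.cos ω • cor (p 0) (p 0) - Real.cos φ • cor (p 0) (p 1)) +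
     (Real.cos φ * Real.cos ω) •
      (Real.cos (θ + φ) • cor (p 1) (p 1) - Real.cos (θ + ω) • cor (p 1) (p 0)))

theorem B_eq (θ φ ω : ℝ) :
    B θ φ ω 1 = combo θ φ ω 1 ∧ B θ φ ω 0 = combo θ φ ω (Equiv.swap 0 1) := by
  refine ⟨rfl, ?_⟩
  simp only [combo, ← swapSettings_cor]
  rfl

/-- If a factor vanished, the identities above would split the four cosines into two equal products,
so their total product would be a square and could not be negative. -/
theorem sin_mul_sin_ne_zero {θ φ ω : ℝ}
    (h : Real.cos (θ + φ) * Real.cos φ * Real.cos (θ + ω) * Real.cos ω < 0) :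
    Real.sin θ * Real.sin (ω - φ) * Real.sin (θ + φ + ω) ≠ 0 := by
  have h1 := cos_mul_cos_sub_fst θ φ ω
  have h2 := cos_mul_cos_sub_cross θ φ ω
  intro h0
  rcases mul_eq_zero.1 h0 with h0 | h0
  · rw [h0, sub_eq_zero] at h2
    have e : Real.cos (θ + φ) * Real.cos φ * Real.cos (θ + ω) * Real.cos ω
        = (Real.cos (θ + φ) * Real.cos ω) ^ 2 := by
      linear_combination -(Real.cos (θ + φ) * Real.cos ω) * h2
    exact absurd h (not_lt.2 (e ▸ sq_nonneg _))
  · rw [h0, mul_zero, sub_eq_zero] at h1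
    have e : Real.cos (θ + φ) * Real.cos φ * Real.cos (θ + ω) * Real.cos ω
        = (Real.cos φ * Real.cos ω) ^ 2 := by
      linear_combination -(Real.cos φ * Real.cos ω) * h1
    exact absurd h (not_lt.2 (e ▸ sq_nonneg _))

theorem combo_boundedBy {θ φ ω : ℝ}
    (h : Real.cos (θ + φ) * Real.cos φ * Real.cos (θ + ω) * Real.cos ω < 0)
    (p : Equiv.Perm (Fin 2)) :
    BellFunctional.BoundedBy.{u} 1 (combo θ φ ω p) := by
  have hβ := sin_mul_sin_ne_zero h
  have h1 := cos_mul_cos_sub_fst θ φ ω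
  have h2 := cos_mul_cos_sub_cross θ φ ω
  have h3 := cos_mul_cos_sub_snd θ φ ω
  have hβ' : β θ φ ω = Real.sin θ * Real.sin (ω - φ) * Real.sin (θ + φ + ω) := rfl
  rw [← hβ'] at hβ
  have hS : Real.sin (ω - φ) ≠ 0 := fun h0 => hβ (by rw [hβ', h0]; ring)
  simp only [combo]
  generalize β θ φ ω = b at *
  generalize Real.sin (ω - φ) = S at *
  generalize Real.sin (θ + φ + ω) = D at *
  generalize Real.sin θ = T at *
  generalize Real.cos (θ + φ) = c₁ at *
  generalize Real.cos (θ + ω) = c₂ at *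
  generalize Real.cos φ = c₃ at *
  generalize Real.cos ω = c₄ at *
  -- The two summands are the weights `l₀, l₁`. They sum to `1`, and the sign hypothesis makes their
  -- product positive, so both are nonnegative.
  have hl : -(c₁ * c₂ * S / b) + c₃ * c₄ * S / b = 1 := by
    field_simp
    linear_combination S * h1 - hβ'
  have hll : 0 < -(c₁ * c₂ * S / b) * (c₃ * c₄ * S / b) := by
    have : -(c₁ * c₂ * S / b) * (c₃ * c₄ * S / b) = -(c₁ * c₃ * c₂ * c₄) * (S / b) ^ 2 := by ring
    rw [this]
    have : 0 < (S / b) ^ 2 := by positivity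
    exact mul_pos (neg_pos.2 h) this
  have hl₀ : 0 ≤ -(c₁ * c₂ * S / b) := by
    by_contra hn
    nlinarith
  have hl₁ : 0 ≤ c₃ * c₄ * S / b := by
    by_contra hn
    nlinarith
  refine boundedBy_of_observable fun ι K hK => ?_
  have ha : ∀ x, IsObservable (opLin K (corFst x)) := fun x => opLin_mono_isObservable hK _
  have hb : ∀ y, IsObservable (opLin K (corSnd y)) := fun y => opLin_mono_isObservable hK _
  have hc := commute_corFst_corSnd K
  -- On `φp` the first party's observable at angle `s` acts as the second party's at `π/2 - s`. The
  -- `p`'s are the coordinates, by Cramer's rule, of the directions `π/2` and `π/2 - θ` in the basis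
  -- of directions `φ, ω`, so the squares in the bound annihilate `φp`.
  have key := bipartite_bound (p₀₀ := -c₄ / S) (p₀₁ := c₃ / S) (p₁₀ := -c₂ / S) (p₁₁ := c₁ / S)
    hl₀ hl₁ (by field_simp; ring) (by
      have e : -(c₁ * c₂ * S / b) * (-c₄ / S) ^ 2 + c₃ * c₄ * S / b * (-c₂ / S) ^ 2 +
          (-(c₁ * c₂ * S / b) * (c₃ / S) ^ 2 + c₃ * c₄ * S / b * (c₁ / S) ^ 2) = 1 := by
        field_simp
        linear_combination (c₁ * c₃ - c₂ * c₄) * h2 + T * S * h3 - S * hβ'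
      linear_combination hl + e) (ha (p 0)) (ha (p 1)) (hb (p 0)) (hb (p 1)) (hc _ _) (hc _ _)
      (hc _ _) (hc _ _)
  have e : opLin K ((1 / b) • ((c₁ * c₂) • (c₄ • cor (p 0) (p 0) - c₃ • cor (p 0) (p 1)) +
        (c₃ * c₄) • (c₁ • cor (p 1) (p 1) - c₂ • cor (p 1) (p 0)))) =
      ((-(c₁ * c₂ * S / b) * (-c₄ / S) : ℝ) : ℂ) •
          (opLin K (corFst (p 0)) * opLin K (corSnd (p 0))) +
        ((-(c₁ * c₂ * S / b) * (c₃ / S) : ℝ) : ℂ) •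
          (opLin K (corFst (p 0)) * opLin K (corSnd (p 1))) +
        ((c₃ * c₄ * S / b * (-c₂ / S) : ℝ) : ℂ) •
          (opLin K (corFst (p 1)) * opLin K (corSnd (p 0))) +
        ((c₃ * c₄ * S / b * (c₁ / S) : ℝ) : ℂ) •
          (opLin K (corFst (p 1)) * opLin K (corSnd (p 1))) := by
    simp only [opLin_smul, map_add, map_sub, opLin_cor]
    have hS' : (S : ℂ) ≠ 0 := by exact_mod_cast hS
    have hb' : (b : ℂ) ≠ 0 := by exact_mod_cast hβ
    push_cast
    match_scalars <;> field_simp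
  rw [e]
  simpa using key

theorem K_isReflection (θ φ ω : ℝ) (v x : Fin 2) :
    IsSelfAdjoint (K θ φ ω v x) ∧ K θ φ ω v x * K θ φ ω v x = 1 := by
  fin_cases v <;> fin_cases x
  · exact ⟨σX_isSelfAdjoint, σX_mul_self⟩
  all_goals exact equatorial_isReflection _

/-- The coefficients of `combo` contracted with a function of the pairs of settings. -/
noncomputable def contract (θ φ ω : ℝ) (f : Fin 2 → Fin 2 → ℝ) : ℝ :=
  1 / β θ φ ω * (Real.cos (θ + φ) * Real.cos (θ + ω) *
    (Real.cos ω * f 0 0 - Real.cos φ * f 0 1) +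
     Real.cos φ * Real.cos ω * (Real.cos (θ + φ) * f 1 1 - Real.cos (θ + ω) * f 1 0))

theorem combo_ket {θ φ ω : ℝ} {K : Fin 2 → Fin 2 → Op (Fin 2)} {p : Equiv.Perm (Fin 2)}
    {s t : Fin 2 → ℝ} (hs : ∀ x, K 0 (p x) = equatorial (s x))
    (ht : ∀ y, K 1 (p y) = equatorial (t y)) {c d : ℝ}
    (hc : contract θ φ ω (fun x y => Real.cos (s x + t y)) = c)
    (hd : contract θ φ ω (fun x y => Real.sin (s x + t y)) = d) :
    opLin K (combo θ φ ω p) (ket ![0, 0]) = ((c : ℂ) + Complex.I * d) • ket ![1, 1] ∧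
    opLin K (combo θ φ ω p) (ket ![1, 1]) = ((c : ℂ) - Complex.I * d) • ket ![0, 0] := by
  have h := fun x y => opLin_cor_ket (hs x) (ht y)
  simp only [combo, opLin_smul, map_add, map_sub, smul_apply, add_apply, sub_apply, h, ← hc, ← hd,
    contract]
  push_cast
  constructor <;> module

/-- The phases add up to `i`, so the states `|00⟩ ± i|11⟩` are eigenvectors with eigenvalues `±1`.
-/
theorem combo_ket_one {θ φ ω : ℝ}
    (h : Real.cos (θ + φ) * Real.cos φ * Real.cos (θ + ω) * Real.cos ω < 0) :
    (B θ φ ω 1).op (K θ φ ω) (ket ![0, 0]) = Complex.I • ket ![1, 1] ∧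
    (B θ φ ω 1).op (K θ φ ω) (ket ![1, 1]) = -Complex.I • ket ![0, 0] := by
  have hβ : β θ φ ω ≠ 0 := sin_mul_sin_ne_zero h
  have h1 := cos_mul_cos_sub_fst θ φ ω
  have h4 : Real.sin (θ + ω) * Real.cos (θ + φ) - Real.cos (θ + ω) * Real.sin (θ + φ)
      = Real.sin (ω - φ) := by
    rw [← Real.sin_sub]
    ring_nf
  have hβ' : β θ φ ω = Real.sin θ * Real.sin (ω - φ) * Real.sin (θ + φ + ω) := rfl
  obtain ⟨e0, e1⟩ := combo_ket (θ := θ) (φ := φ) (ω := ω) (K := K θ φ ω) (p := 1) (s := ![0, θ])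
    (t := ![φ, ω]) (c := 0) (d := 1)
    (fun x => by fin_cases x; exacts [equatorial_zero.symm, rfl])
    (fun y => by fin_cases y <;> rfl)
    (by
      simp only [contract, Matrix.cons_val_zero, Matrix.cons_val_one, zero_add]
      ring)
    (by
      simp only [contract, Matrix.cons_val_zero, Matrix.cons_val_one, zero_add]
      field_simp
      rw [Real.sin_sub] at h4 hβ'
      linear_combination (Real.cos φ * Real.cos ω) * h4 +
        (Real.sin ω * Real.cos φ - Real.cos ω * Real.sin φ) * h1 - hβ')
  rw [(B_eq θ φ ω).1, ← opLin_apply, e0, e1]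
  constructor <;> push_cast <;> module

/-- Exchanging the settings turns the phase `i` into `-i e^{iδ}` with `δ = θ + φ + ω`. -/
theorem combo_ket_zero {θ φ ω : ℝ}
    (h : Real.cos (θ + φ) * Real.cos φ * Real.cos (θ + ω) * Real.cos ω < 0) :
    (B θ φ ω 0).op (K θ φ ω) (ket ![0, 0]) =
      ((Real.sin (θ + φ + ω) : ℂ) - Complex.I * Real.cos (θ + φ + ω)) • ket ![1, 1] ∧
    (B θ φ ω 0).op (K θ φ ω) (ket ![1, 1]) =
      ((Real.sin (θ + φ + ω) : ℂ) + Complex.I * Real.cos (θ + φ + ω)) • ket ![0, 0] := by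
  have hβ : β θ φ ω ≠ 0 := sin_mul_sin_ne_zero h
  have h1 := cos_mul_cos_sub_fst θ φ ω
  have h3 := cos_mul_cos_sub_snd θ φ ω
  have h4 := sin_mul_cos_sub_fst θ φ ω
  have h5 := sin_mul_cos_sub_snd θ φ ω
  have hβ' : β θ φ ω = Real.sin θ * Real.sin (ω - φ) * Real.sin (θ + φ + ω) := rfl
  obtain ⟨e0, e1⟩ := combo_ket (θ := θ) (φ := φ) (ω := ω) (K := K θ φ ω) (p := Equiv.swap 0 1)
    (s := ![θ, 0]) (t := ![ω, φ]) (c := Real.sin (θ + φ + ω)) (d := -Real.cos (θ + φ + ω))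
    (fun x => by fin_cases x; exacts [rfl, equatorial_zero.symm])
    (fun y => by fin_cases y <;> rfl)
    (by
      simp only [contract, Matrix.cons_val_zero, Matrix.cons_val_one, zero_add]
      field_simp
      linear_combination (Real.cos (θ + φ) * Real.cos φ - Real.cos (θ + ω) * Real.cos ω) * h1 +
        (Real.sin θ * Real.sin (θ + φ + ω)) * h3 - Real.sin (θ + φ + ω) * hβ')
    (by
      simp only [contract, Matrix.cons_val_zero, Matrix.cons_val_one, zero_add]
      field_simp
      linear_combination (Real.cos (θ + φ) * Real.cos (θ + ω)) * h4 +
        (Real.cos φ * Real.cos ω) * h5 - (Real.cos (θ + φ + ω) * Real.sin (ω - φ)) * h1 +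
        Real.cos (θ + φ + ω) * hβ')
  rw [(B_eq θ φ ω).2, ← opLin_apply, e0, e1]
  constructor <;> push_cast <;> module

theorem eigen {θ φ ω : ℝ}
    (h : Real.cos (θ + φ) * Real.cos φ * Real.cos (θ + ω) * Real.cos ω < 0) :
    (B θ φ ω 1).op (K θ φ ω) φp = φp ∧
      (B θ φ ω 1).op (K θ φ ω) φm = -φm ∧
      (B θ φ ω 0).op (K θ φ ω) φp = -(Real.cos (θ + φ + ω) : ℂ) • φp
          + (Complex.I * (Real.sin (θ + φ + ω) : ℂ)) • φm ∧
      (B θ φ ω 0).op (K θ φ ω) φm = (Real.cos (θ + φ + ω) : ℂ) • φm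
          - (Complex.I * (Real.sin (θ + φ + ω) : ℂ)) • φp := by
  obtain ⟨a0, a1⟩ := combo_ket_one h
  obtain ⟨b0, b1⟩ := combo_ket_zero h
  have hI := Complex.I_mul_I
  simp only [φp, φm, map_smul, map_add, map_sub, a0, a1, b0, b1]
  generalize ((1 / √2 : ℝ) : ℂ) = r
  generalize (Real.cos (θ + φ + ω) : ℂ) = c
  generalize (Real.sin (θ + φ + ω) : ℂ) = s
  have k0 := fun z : ℂ => congrArg (· • ket (![0, 0] : Fin 2 → Fin 2)) (congrArg (z * ·) hI)
  have k1 := fun z : ℂ => congrArg (· • ket (![1, 1] : Fin 2 → Fin 2)) (congrArg (z * ·) hI)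
  refine ⟨?_, ?_, ?_, ?_⟩
  · linear_combination (norm := module) -k0 r
  · linear_combination (norm := module) k0 r
  · linear_combination (norm := module) k0 (r * c) + k1 (r * s)
  · linear_combination (norm := module) -k0 (r * c) + k1 (r * s)

theorem orthonormal : ‖φp‖ = 1 ∧ ‖φm‖ = 1 ∧ inner ℂ φp φm = 0 := by
  have hr : ((1 / √2 : ℝ) : ℂ) * ((1 / √2 : ℝ) : ℂ) = 1 / 2 := by
    rw [← Complex.ofReal_mul, div_mul_div_comm, Real.mul_self_sqrt (by norm_num)]
    norm_num
  have hI := Complex.I_mul_I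
  have n1 : (![0, 0] : Fin 2 → Fin 2) ≠ ![1, 1] := by decide
  refine ⟨norm_eq_one_of_inner ?_, norm_eq_one_of_inner ?_, ?_⟩ <;>
  simp only [φp, φm, inner_add_left, inner_add_right, inner_sub_left, inner_sub_right,
    inner_smul_left, inner_smul_right, inner_ket_ket, Complex.conj_ofReal, Complex.conj_I, if_true,
    if_neg n1, if_neg n1.symm]
  · linear_combination 2 * hr - ((1 / √2 : ℝ) : ℂ) * ((1 / √2 : ℝ) : ℂ) * hI
  · linear_combination 2 * hr - ((1 / √2 : ℝ) : ℂ) * ((1 / √2 : ℝ) : ℂ) * hI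
  · linear_combination ((1 / √2 : ℝ) : ℂ) * ((1 / √2 : ℝ) : ℂ) * hI

theorem givesComplex {θ φ ω : ℝ}
    (h : Real.cos (θ + φ) * Real.cos φ * Real.cos (θ + ω) * Real.cos ω < 0) :
    GivesComplex.{u} (B θ φ ω) (K θ φ ω) φp (-φm)
      ![-(Real.cos (θ + φ + ω) : ℂ) • σZ - (Real.sin (θ + φ + ω) : ℂ) • σY, σZ] := by
  obtain ⟨h1, h2, h3, h4⟩ := eigen h
  obtain ⟨hp, hm, horth⟩ := orthonormal
  have hS : -(Real.cos (θ + φ + ω) : ℂ) • σZ - (Real.sin (θ + φ + ω) : ℂ) • σY =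
      ((-Real.cos (θ + φ + ω) : ℝ) : ℂ) • σZ + ((-Real.sin (θ + φ + ω) : ℝ) : ℂ) • σY := by
    push_cast
    module
  have hS' := reflection_of_anticommute σZ_isSelfAdjoint σY_isSelfAdjoint σZ_mul_self σY_mul_self
    (by rw [σY_mul_σZ, add_neg_cancel])
    (show (-Real.cos (θ + φ + ω)) ^ 2 + (-Real.sin (θ + φ + ω)) ^ 2 = 1 by
      rw [neg_sq, neg_sq, Real.cos_sq_add_sin_sq])
  rw [← hS] at hS'
  refine givesComplex_of_intertwining ?_ (fun v x => (K_isReflection θ φ ω v x).1)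
    (fun v x => (K_isReflection θ φ ω v x).2) ?_ ?_ hp (by rw [norm_neg, hm])
    (by rw [inner_neg_right, horth, neg_zero]) ?_ <;> intro y <;> fin_cases y
  · exact (B_eq θ φ ω).2 ▸ combo_boundedBy h _
  · exact (B_eq θ φ ω).1 ▸ combo_boundedBy h _
  · exact hS'.1
  · exact σZ_isSelfAdjoint
  · exact hS'.2
  · exact σZ_mul_self
  -- The second basis vector is `-φm`; this sign makes the off-diagonal part `-sin δ σY` rather than
  -- `+sin δ σY`.
  · refine comp_coisometryOf_adjoint (a := -(Real.cos (θ + φ + ω) : ℂ))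
      (b := -(Complex.I * Real.sin (θ + φ + ω))) (c := Complex.I * Real.sin (θ + φ + ω))
      (d := Real.cos (θ + φ + ω)) (h3.trans ?_) ((map_neg _ _).trans ((congrArg _ h4).trans ?_))
      (?_ : -(Real.cos (θ + φ + ω) : ℂ) • σZ (ket 0) - (Real.sin (θ + φ + ω) : ℂ) • σY (ket 0) = _)
      (?_ : -(Real.cos (θ + φ + ω) : ℂ) • σZ (ket 1) - (Real.sin (θ + φ + ω) : ℂ) • σY (ket 1) = _)
    · module
    · module
    · rw [σZ_ket_zero, σY_ket_zero]
      module
    · rw [σZ_ket_one, σY_ket_one]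
      module
  · refine comp_coisometryOf_adjoint (a := 1) (b := 0) (c := 0) (d := -1) (h1.trans ?_)
      ((map_neg _ _).trans ((congrArg _ h2).trans ?_)) (σZ_ket_zero.trans ?_)
      (σZ_ket_one.trans ?_) <;> module

end WBC

/-! ### Graph states and the BASTA functionals -/

theorem tensorOp_eq_neg {V : Type*} [Fintype V] {ι : V → Type*} {A B : ∀ v, Op (ι v)} (i : V)
    (hi : A i = -B i) (h : ∀ v ≠ i, A v = B v) : tensorOp A = -tensorOp B := by
  classical
  have : A = Function.update B i ((-1 : ℂ) • B i) := by
    funext v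
    by_cases hv : v = i
    · subst hv
      rw [Function.update_self, hi, neg_one_smul]
    · rw [Function.update_of_ne hv, h v hv]
  rw [this, ← tensorMap_apply, MultilinearMap.map_update_smul, Function.update_eq_self,
    neg_one_smul, tensorMap_apply]

theorem BoundedBy.neg {V : Type} [Fintype V] [DecidableEq V] {c : ℝ} {B : BellFunctional V}
    (h : BellFunctional.BoundedBy.{u} c B) : BellFunctional.BoundedBy.{u} c (-B) := by
  rw [boundedBy_iff] at *
  intro ι A hA
  obtain ⟨h1, h2⟩ := h ι A hA
  rw [map_neg, sub_neg_eq_add, ← sub_eq_add_neg]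
  exact ⟨h2, h1⟩

theorem σX_ket (t : Fin 2) : σX (ket t) = ket (t + 1) := by
  fin_cases t
  · exact σX_ket_zero
  · exact σX_ket_one

theorem σZ_ket (t : Fin 2) : σZ (ket t) = (-1 : ℂ) ^ (t : ℕ) • ket t := by
  fin_cases t
  · exact σZ_ket_zero.trans (by simp)
  · exact σZ_ket_one.trans (by simp)

namespace BASTA

/-- `⨂_v Z_v`. -/
noncomputable def parity (V : Type) [Fintype V] : Op (V → Fin 2) := tensorOp fun _ => σZ

theorem parity_isSelfAdjoint (V : Type) [Fintype V] : IsSelfAdjoint (parity V) :=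
  tensorOp_isSelfAdjoint fun _ => σZ_isSelfAdjoint

theorem K_of_ne {V : Type} [DecidableEq V] (i : V) {v : V} (hv : v ≠ i) : K i v = ![σX, σZ] := if_neg hv

/-- The observables at `i` are `X` and `Z` rotated by 45 degrees. Their sum, and in the next lemma
their difference, collapses two terms of the functional into one Pauli string with a factor `√2`. -/
theorem K_self_add {V : Type} [DecidableEq V] (i : V) : K i i 0 + K i i 1 = ((√2 : ℝ) : ℂ) • σX := by
  have h : ((1 / √2 : ℝ) : ℂ) + ((1 / √2 : ℝ) : ℂ) = ((√2 : ℝ) : ℂ) := by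
    rw [← Complex.ofReal_add, ← two_mul, mul_one_div, Real.div_sqrt]
  rw [K, if_pos rfl, ← h]
  simp only [Matrix.cons_val_zero, Matrix.cons_val_one]
  module

theorem K_self_sub {V : Type} [DecidableEq V] (i : V) :
    K i i 0 - K i i 1 = ((√2 : ℝ) : ℂ) • σZ := by
  have h : ((1 / √2 : ℝ) : ℂ) + ((1 / √2 : ℝ) : ℂ) = ((√2 : ℝ) : ℂ) := by
    rw [← Complex.ofReal_add, ← two_mul, mul_one_div, Real.div_sqrt]
  rw [K, if_pos rfl, ← h]
  simp only [Matrix.cons_val_zero, Matrix.cons_val_one]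
  module

theorem K_isReflection {V : Type} [DecidableEq V] (i v : V) (x : Fin 2) :
    IsSelfAdjoint (K i v x) ∧ K i v x * K i v x = 1 := by
  by_cases hv : v = i
  · subst hv
    have h2 : (1 / √2) ^ 2 = 1 / 2 := by
      rw [div_pow, Real.sq_sqrt (by norm_num), one_pow]
    have r := fun b hb => reflection_of_anticommute σX_isSelfAdjoint σZ_isSelfAdjoint σX_mul_self
      σZ_mul_self (by rw [σX_mul_σZ, neg_add_cancel]) (a := 1 / √2) (b := b) hb
    rw [K, if_pos rfl]
    fin_cases x
    · have := r (1 / √2) (by rw [h2]; norm_num)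
      rwa [← smul_add] at this
    · have := r (-(1 / √2)) (by rw [neg_sq, h2]; norm_num)
      rwa [Complex.ofReal_neg, neg_smul, ← sub_eq_add_neg, ← smul_sub] at this
  · rw [K_of_ne i hv]
    fin_cases x
    exacts [⟨σX_isSelfAdjoint, σX_mul_self⟩, ⟨σZ_isSelfAdjoint, σZ_mul_self⟩]

theorem normalized {V : Type} [Fintype V] {G : SimpleGraph V} [DecidableRel G.Adj] {i : V}
    (hi : 0 < G.degree i) : 0 < β₀ G i ∧ 0 < β₁ G i := by
  have hd : (1 : ℝ) ≤ G.degree i := by exact_mod_cast hi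
  have hq : (1 : ℝ) ≤ Fintype.card V := by exact_mod_cast Fintype.card_pos_iff.2 ⟨i⟩
  have h2 : 1 < √2 := Real.lt_sqrt_of_sq_lt (by norm_num)
  constructor
  · rw [β₀]
    positivity
  · rw [β₁]
    nlinarith

variable {V : Type} [Fintype V] [DecidableEq V]

/-! #### Bounds -/

/-- `K_x^{(i)} ⨂_{v ≠ i} K^{(v)}_{s v}`. -/
def attach (i : V) (s : V → Option (Fin 2)) (x : Fin 2) : BellFunctional V :=
  mono fun v => if v = i then some x else s v

/-- This is a CHSH expression between the vertex `i` and all the others: `s` and `t` describe the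
two joint observables of the rest, which need not commute with each other. -/
theorem attach_boundedBy (i : V) (s t : V → Option (Fin 2)) (x y : Fin 2) :
    BellFunctional.BoundedBy.{u} (2 * √2)
      (attach i s x + attach i s y + attach i t x - attach i t y) := by
  refine boundedBy_of_observable fun ι K hK => ?_
  have split : ∀ s z, opLin K (attach i s z) =
      opLin K (mono fun v => if v = i then some z else none) *
        opLin K (mono fun v => if v = i then none else s v) := fun s z => by
    rw [attach, opLin_mono_mul]
    intro v
    by_cases hv : v = i <;> simp [hv]
  have comm : ∀ (s : V → Option (Fin 2)) z, Commute (opLin K (mono fun v => if v = i then some z else none))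
      (opLin K (mono fun v => if v = i then none else s v)) := fun s z => by
    refine opLin_mono_commute K fun v => ?_
    by_cases hv : v = i <;> simp [hv]
  simp only [map_add, map_sub, split]
  have ob := opLin_mono_isObservable hK
  exact chsh_bound (ob _) (ob _) (ob _) (ob _) (comm _ _) (comm _ _) (comm _ _) (comm _ _)

variable (G : SimpleGraph V) [DecidableRel G.Adj] (i : V)

theorem card_far : ((Finset.univ.filter fun j => j ≠ i ∧ ¬ G.Adj i j).card : ℝ)
    = Fintype.card V - 1 - G.degree i := by
  have h : (Finset.univ.filter fun j => j ≠ i ∧ ¬ G.Adj i j)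
      = (insert i (G.neighborFinset i))ᶜ := by
    ext j
    simp
  have h2 : (insert i (G.neighborFinset i)).card = G.degree i + 1 := by
    rw [Finset.card_insert_of_notMem (by simp), G.card_neighborFinset_eq_degree]
  rw [h, Finset.card_compl, Nat.cast_sub (Finset.card_le_univ _), h2]
  push_cast
  ring

/-- The factor `n₁` supplies one copy of the central terms per neighbour; each copy forms a CHSH
expression with that neighbour's terms and costs `2√2`. Each of the `q - 1 - n₁` far monomials costs
`1`. -/
theorem B_boundedBy : BellFunctional.BoundedBy.{u} (β₁ G i) (B G i) := by
  have h := BoundedBy.add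
    (BoundedBy.sum.{u} (G.neighborFinset i) fun j _ => attach_boundedBy i
      (fun v => if G.Adj i v then some 1 else none)
      (fun v => if v = j then some 0 else if G.Adj j v then some 1 else none) 0 1)
    (BoundedBy.sum.{u} (Finset.univ.filter fun j => j ≠ i ∧ ¬ G.Adj i j)
      fun j _ => boundedBy_mono (fun v => if v = j then some 0 else if G.Adj j v then some 1 else none))
  convert h using 1
  · rw [card_far, G.card_neighborFinset_eq_degree, β₁]
    ring
  · rw [B]
    simp only [add_sub_assoc, Finset.sum_add_distrib, Finset.sum_const,
      G.card_neighborFinset_eq_degree, smul_add, ← Nat.cast_smul_eq_nsmul ℝ]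
    rfl

theorem B'_boundedBy : BellFunctional.BoundedBy.{u} (2 * √2 * G.degree i) (B' G i) := by
  -- In `-B'`, taking the settings of `i` in the order `1, 0` exhibits one CHSH expression per
  -- neighbour.
  have h := BoundedBy.neg
    (BoundedBy.sum.{u} (G.neighborFinset i) fun j _ => attach_boundedBy i
      (fun v => if v = j then some 0 else if (G.Adj i v ↔ G.Adj j v) then some 1 else none)
      (fun _ => some 1) 1 0)
  convert h using 1
  · rw [G.card_neighborFinset_eq_degree]
    ring
  · rw [B']
    simp only [add_sub_assoc, Finset.sum_add_distrib, Finset.sum_const,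
      G.card_neighborFinset_eq_degree, ← Nat.cast_smul_eq_nsmul ℝ]
    change (G.degree i : ℝ) • (attach i (fun _ => some 1) 0 - attach i (fun _ => some 1) 1)
      - (∑ j ∈ G.neighborFinset i, evenTerm G i j 0 + ∑ j ∈ G.neighborFinset i, evenTerm G i j 1)
      = -(∑ j ∈ G.neighborFinset i, evenTerm G i j 1 + ∑ j ∈ G.neighborFinset i, evenTerm G i j 0
      + (G.degree i : ℝ) • (attach i (fun _ => some 1) 1 - attach i (fun _ => some 1) 0))
    module

/-! #### Stabilizers of the graph state -/

theorem neg_one_pow_edgeCount (x : V → Fin 2) : (-1 : ℂ) ^ edgeCount G x =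
    ∏ e ∈ G.edgeFinset, if ∀ v ∈ e, x v = 1 then -1 else 1 := by
  rw [edgeCount, Finset.prod_ite]
  simp

/-- Edges away from `j` contribute the same sign before and after the flip. On an edge `jk`, exactly
one of `x j`, `x j + 1` equals `1`, so the two signs multiply to `(-1)^(x k)`. -/
theorem neg_one_pow_edgeCount_flip (x : V → Fin 2) (j : V) :
    (-1 : ℂ) ^ edgeCount G x * ∏ k ∈ G.neighborFinset j, (-1 : ℂ) ^ (x k : ℕ) =
      (-1 : ℂ) ^ edgeCount G (Function.update x j (x j + 1)) := by
  have key : (-1 : ℂ) ^ edgeCount G x * (-1 : ℂ) ^ edgeCount G (Function.update x j (x j + 1))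
      = ∏ k ∈ G.neighborFinset j, (-1 : ℂ) ^ (x k : ℕ) := by
    rw [neg_one_pow_edgeCount, neg_one_pow_edgeCount, ← Finset.prod_mul_distrib]
    have hinj : Set.InjOn (fun k => s(j, k)) (G.neighborFinset j : Set V) := by
      intro a _ b _ hab
      exact Sym2.congr_right.1 hab
    have hsub : (G.neighborFinset j).image (fun k => s(j, k)) ⊆ G.edgeFinset := by
      intro e he
      obtain ⟨k, hk, rfl⟩ := Finset.mem_image.1 he
      simpa using hk
    rw [← Finset.prod_subset hsub, Finset.prod_image hinj]
    · refine Finset.prod_congr rfl fun k hk => ?_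
      have hkj : k ≠ j := (G.ne_of_adj (by simpa using hk)).symm
      simp only [Sym2.mem_iff, forall_eq_or_imp, forall_eq, Function.update_self,
        Function.update_of_ne hkj]
      generalize x j = a
      generalize x k = b
      fin_cases a <;> fin_cases b <;> simp
    · intro e he hne
      have hj : j ∉ e := by
        intro hj
        obtain ⟨k, rfl⟩ := hj
        exact hne (Finset.mem_image.2 ⟨k, by simpa using he, rfl⟩)
      have : (∀ v ∈ e, Function.update x j (x j + 1) v = 1) ↔ ∀ v ∈ e, x v = 1 := by
        refine forall₂_congr fun v hv => ?_
        rw [Function.update_of_ne (by rintro rfl; exact hj hv)]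
      simp only [this]
      split_ifs <;> norm_num
  rw [← key, ← mul_assoc, ← mul_pow]
  norm_num

theorem stabilizer_ket (x : V → Fin 2) (j : V) : stabilizer G j (ket x) =
    (∏ k ∈ G.neighborFinset j, (-1 : ℂ) ^ (x k : ℕ)) • ket (Function.update x j (x j + 1)) := by
  have h : ∀ v, (if v = j then σX else if G.Adj j v then σZ else 1 : Op (Fin 2)) (ket (x v)) =
      (if G.Adj j v then (-1 : ℂ) ^ (x v : ℕ) else 1) •
        ket (Function.update x j (x j + 1) v) := by
    intro v
    by_cases hv : v = j
    · subst hv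
      simp [σX_ket]
    · by_cases ha : G.Adj j v
      · simp [hv, ha, σZ_ket]
      · simp [hv, ha]
  rw [stabilizer, tensorOp_ket_of_monomial h, Finset.prod_ite]
  simp [SimpleGraph.neighborFinset_eq_filter]

/-- The stabilizer flips `x j` with exactly the ratio of the two amplitudes, so it merely permutes
the terms of the sum. -/
theorem stabilizer_φp (j : V) : stabilizer G j (φp G) = φp G := by
  rw [φp, map_smul, map_sum]
  congr 1
  simp only [map_smul, stabilizer_ket, smul_smul, neg_one_pow_edgeCount_flip]
  have hinv : Function.Involutive fun x : V → Fin 2 => Function.update x j (x j + 1) := by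
    intro x
    have : ∀ a : Fin 2, a + 1 + 1 = a := by decide
    simp [this]
  exact Equiv.sum_comp hinv.toPerm fun x => (-1 : ℂ) ^ edgeCount G x • ket x

theorem parity_φp : parity V (φp G) = φm G := by
  rw [φp, φm, map_smul, map_sum]
  congr 1
  refine Finset.sum_congr rfl fun x _ => ?_
  rw [map_smul, parity, tensorOp_ket_of_monomial fun v => σZ_ket (x v), smul_smul,
    Finset.prod_pow_eq_pow_sum, ← pow_add]

theorem parity_mul_self : parity V * parity V = 1 := by
  rw [parity, tensorOp_mul, σZ_mul_self, tensorOp_one]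

theorem parity_φm : parity V (φm G) = φp G := by
  rw [← parity_φp, ← mul_apply_eq_comp, parity_mul_self, one_apply_eq_self]

theorem stabilizer_isSelfAdjoint (j : V) : IsSelfAdjoint (stabilizer G j) := by
  refine tensorOp_isSelfAdjoint fun v => ?_
  split_ifs
  exacts [σX_isSelfAdjoint, σZ_isSelfAdjoint, .one _]

/-- All factors commute except those at `j`, where `X` meets `Z`. -/
theorem stabilizer_mul_parity (j : V) :
    stabilizer G j * parity V = -(parity V * stabilizer G j) := by
  rw [stabilizer, parity, tensorOp_mul, tensorOp_mul]
  refine tensorOp_eq_neg j ?_ fun v hv => ?_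
  · rw [if_pos rfl, σX_mul_σZ]
  · rw [if_neg hv]
    split_ifs <;> simp

theorem stabilizer_φm (j : V) : stabilizer G j (φm G) = -φm G := by
  rw [← parity_φp, ← mul_apply_eq_comp, stabilizer_mul_parity]
  change -(parity V (stabilizer G j (φp G))) = _
  rw [stabilizer_φp]

/-- The parity is a self-adjoint involution, which carries the norm over. Orthogonality comes from
opposite eigenvalues of one stabilizer, hence the vertex `i`: without vertices the two states
coincide. -/
theorem orthonormal (i : V) : ‖φp G‖ = 1 ∧ ‖φm G‖ = 1 ∧ inner ℂ (φp G) (φm G) = 0 := by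
  have hq : (0 : ℝ) < 2 ^ Fintype.card V := by positivity
  have hp : inner ℂ (φp G) (φp G) = 1 := by
    have hsq : ∀ (r : ℂ) (n : ℕ), (-1) ^ n * (r * (-1) ^ n) = r := fun r n => by
      rw [mul_left_comm, ← mul_pow]
      norm_num
    simp only [φp, inner_smul_left, inner_smul_right, sum_inner, inner_sum, inner_ket_ket,
      Complex.conj_ofReal, map_pow, map_neg, map_one]
    simp only [mul_ite, mul_one, mul_zero, Finset.sum_ite_eq', Finset.mem_univ, if_true, hsq]
    rw [Finset.sum_const, Finset.card_univ, Fintype.card_fun, Fintype.card_fin, nsmul_eq_mul,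
      mul_left_comm, ← Complex.ofReal_mul, div_mul_div_comm, Real.mul_self_sqrt hq.le]
    push_cast
    field_simp
  refine ⟨norm_eq_one_of_inner hp, norm_eq_one_of_inner ?_, ?_⟩
  · nth_rewrite 1 [← parity_φp]
    rw [← ContinuousLinearMap.adjoint_inner_right, ← ContinuousLinearMap.star_eq_adjoint,
      (parity_isSelfAdjoint V).star_eq, parity_φm, hp]
  · have h : inner ℂ (φp G) (φm G) = -inner ℂ (φp G) (φm G) := by
      nth_rewrite 1 [← stabilizer_φp G i]
      rw [← ContinuousLinearMap.adjoint_inner_right, ← ContinuousLinearMap.star_eq_adjoint,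
        (stabilizer_isSelfAdjoint G i).star_eq, stabilizer_φm, inner_neg_right]
    exact self_eq_neg.1 h

/-! #### The Bell operators on the graph and antigraph states -/

theorem opLin_attach (s : V → Option (Fin 2)) (x : Fin 2) : opLin (K i) (attach i s x) =
    tensorMap _ (Function.update (fun v => (s v).elim 1 (K i v)) i (K i i x)) := by
  rw [attach, opLin_mono, tensorMap_apply]
  congr 1
  funext v
  by_cases hv : v = i
  · subst hv
    simp
  · simp [hv]

theorem opLin_attach_add (s : V → Option (Fin 2)) {A : V → Op (Fin 2)} (hi : A i = σX)
    (hA : ∀ v ≠ i, A v = (s v).elim 1 ![σX, σZ]) :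
    opLin (K i) (attach i s 0 + attach i s 1) = ((√2 : ℝ) : ℂ) • tensorOp A := by
  rw [map_add, opLin_attach, opLin_attach, ← MultilinearMap.map_update_add, K_self_add,
    MultilinearMap.map_update_smul, tensorMap_apply]
  congr 2
  funext v
  by_cases hv : v = i
  · subst hv
    rw [Function.update_self, hi]
  · rw [Function.update_of_ne hv, hA v hv, K_of_ne i hv]

theorem opLin_attach_sub (s : V → Option (Fin 2)) {A : V → Op (Fin 2)} (hi : A i = σZ)
    (hA : ∀ v ≠ i, A v = (s v).elim 1 ![σX, σZ]) :
    opLin (K i) (attach i s 0 - attach i s 1) = ((√2 : ℝ) : ℂ) • tensorOp A := by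
  rw [map_sub, opLin_attach, opLin_attach, ← MultilinearMap.map_update_sub, K_self_sub,
    MultilinearMap.map_update_smul, tensorMap_apply]
  congr 2
  funext v
  by_cases hv : v = i
  · subst hv
    rw [Function.update_self, hi]
  · rw [Function.update_of_ne hv, hA v hv, K_of_ne i hv]

theorem opLin_central : opLin (K i) (centralTerm G i 0 + centralTerm G i 1)
    = ((√2 : ℝ) : ℂ) • stabilizer G i := by
  refine opLin_attach_add i (fun v => if G.Adj i v then some 1 else none) (if_pos rfl) ?_
  intro v hv
  rw [if_neg hv]
  split_ifs <;> simp

theorem opLin_neighbour {j : V} (hj : G.Adj i j) :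
    opLin (K i) (neighbourTerm G i j 0 - neighbourTerm G i j 1)
      = ((√2 : ℝ) : ℂ) • stabilizer G j := by
  refine opLin_attach_sub i
    (fun v => if v = j then some 0 else if G.Adj j v then some 1 else none) ?_ ?_
  · rw [if_neg (G.ne_of_adj hj), if_pos hj.symm]
  · intro v hv
    split_ifs <;> simp

theorem opLin_far {j : V} (hj : j ≠ i) (hij : ¬ G.Adj i j) :
    opLin (K i) (farTerm G j) = stabilizer G j := by
  rw [farTerm, opLin_mono, stabilizer]
  congr 1
  funext v
  by_cases hv : v = j
  · subst hv
    simp [K_of_ne i hj]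
  · by_cases ha : G.Adj j v
    · have : v ≠ i := by
        rintro rfl
        exact hij ha.symm
      simp [hv, ha, K_of_ne i this]
    · simp [hv, ha]

theorem opLin_full : opLin (K i) (fullTerm i 0 - fullTerm i 1)
    = ((√2 : ℝ) : ℂ) • parity V :=
  opLin_attach_sub i (fun _ => some 1) rfl fun _ _ => rfl

/-- In `P S_i S_j` the factor at `i` is `Z X Z = -X`, which gives the sign, and at `j` it is `Z Z X
= X`. Elsewhere a `Z` survives exactly at the vertices adjacent to both `i` and `j` or to neither.
-/
theorem opLin_even {j : V} (hj : G.Adj i j) :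
    opLin (K i) (evenTerm G i j 0 + evenTerm G i j 1)
      = -(((√2 : ℝ) : ℂ) • (parity V * stabilizer G i * stabilizer G j)) := by
  have hne := G.ne_of_adj hj
  have h := opLin_attach_add i
    (fun v => if v = j then some 0 else if (G.Adj i v ↔ G.Adj j v) then some 1 else none)
    (A := fun v => if v = i then σX else if v = j then σX else
      if (G.Adj i v ↔ G.Adj j v) then σZ else 1) (if_pos rfl) (by
        intro v hv
        rw [if_neg hv]
        split_ifs <;> simp)
  refine Eq.trans h ?_
  rw [← smul_neg]
  congr 1
  rw [parity, stabilizer, stabilizer, tensorOp_mul, tensorOp_mul]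
  refine tensorOp_eq_neg i ?_ fun v hv => ?_
  · rw [if_pos rfl, if_pos rfl, if_neg hne, if_pos hj.symm, mul_assoc, σX_mul_σZ, mul_neg, neg_neg,
      ← mul_assoc, σZ_mul_self, one_mul]
  · rw [if_neg hv, if_neg hv]
    by_cases hvj : v = j
    · subst hvj
      simp [hj, σZ_mul_self]
    · by_cases h1 : G.Adj i v <;> by_cases h2 : G.Adj j v <;> simp [hvj, h1, h2, σZ_mul_self]

/-- The central and neighbour terms each contribute `√2 n₁`, and the far terms `q - 1 - n₁`. The
sign `ε` covers both states. -/
theorem B_op_apply {ψ : Hil (V → Fin 2)} {ε : ℂ} (h : ∀ j, stabilizer G j ψ = ε • ψ) :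
    (B G i).op (K i) ψ = (ε * β₁ G i) • ψ := by
  have e : opLin (K i) (B G i) = ((G.degree i : ℝ) : ℂ) • (((√2 : ℝ) : ℂ) • stabilizer G i) +
      ∑ j ∈ G.neighborFinset i, ((√2 : ℝ) : ℂ) • stabilizer G j +
      ∑ j with j ≠ i ∧ ¬ G.Adj i j, stabilizer G j := by
    rw [B, map_add, map_add, opLin_smul, opLin_central, map_sum, map_sum]
    congr 1
    · congr 1
      exact Finset.sum_congr rfl fun j hj => opLin_neighbour G i (by simpa using hj)
    · refine Finset.sum_congr rfl fun j hj => ?_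
      obtain ⟨-, h1, h2⟩ := Finset.mem_filter.1 hj
      exact opLin_far G i h1 h2
  rw [← opLin_apply, e]
  simp only [add_apply, smul_apply, sum_apply, h, Finset.sum_const, ← Nat.cast_smul_eq_nsmul ℂ]
  have hc : ((Finset.univ.filter fun j => j ≠ i ∧ ¬ G.Adj i j).card : ℂ)
      = Fintype.card V - 1 - G.degree i := by exact_mod_cast card_far G i
  rw [hc, G.card_neighborFinset_eq_degree, β₁]
  push_cast
  module

/-- As `ε² = 1`, the product `S_i S_j` fixes `ψ`, so every neighbour term acts as `√2` times the
parity, like the full term. -/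
theorem B'_op_apply {ψ : Hil (V → Fin 2)} {ε : ℂ} (hε : ε * ε = 1)
    (h : ∀ j, stabilizer G j ψ = ε • ψ) :
    (B' G i).op (K i) ψ = ((2 * √2 * G.degree i : ℝ) : ℂ) • parity V ψ := by
  have e : opLin (K i) (B' G i) = ((G.degree i : ℝ) : ℂ) • (((√2 : ℝ) : ℂ) • parity V) -
      ∑ j ∈ G.neighborFinset i,
        -(((√2 : ℝ) : ℂ) • (parity V * stabilizer G i * stabilizer G j)) := by
    rw [B', map_sub, opLin_smul, opLin_full, map_sum]
    congr 1
    exact Finset.sum_congr rfl fun j hj => opLin_even G i (by simpa using hj)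
  have hp : ∀ j, (parity V * stabilizer G i * stabilizer G j) ψ = parity V ψ := fun j => by
    rw [mul_apply_eq_comp, mul_apply_eq_comp, h, map_smul, h, smul_smul, hε, one_smul]
  rw [← opLin_apply, e]
  simp only [sub_apply, smul_apply, sum_apply, neg_apply, hp, Finset.sum_const,
    ← Nat.cast_smul_eq_nsmul ℂ]
  rw [G.card_neighborFinset_eq_degree]
  push_cast
  module

theorem B_op_φp : (B G i).op (K i) (φp G) = (β₁ G i : ℂ) • φp G := by
  rw [B_op_apply G i (ε := 1) fun j => by rw [stabilizer_φp, one_smul], one_mul]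

theorem B_op_φm : (B G i).op (K i) (φm G) = -(β₁ G i : ℂ) • φm G := by
  rw [B_op_apply G i (ε := -1) fun j => by rw [stabilizer_φm, neg_one_smul], neg_one_mul]

theorem B'_op_φp : (B' G i).op (K i) (φp G) = ((2 * √2 * G.degree i : ℝ) : ℂ) • φm G := by
  rw [B'_op_apply G i (ε := 1) (by norm_num) fun j => by rw [stabilizer_φp, one_smul], parity_φp]

theorem B'_op_φm : (B' G i).op (K i) (φm G) = ((2 * √2 * G.degree i : ℝ) : ℂ) • φp G := by
  rw [B'_op_apply G i (ε := -1) (by norm_num) fun j => by rw [stabilizer_φm, neg_one_smul],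
    parity_φm]

theorem op_one_div_smul {c : ℝ} (hc : 0 < c) {B : BellFunctional V} {d : ℂ}
    {ψ χ : Hil (V → Fin 2)} (h : B.op (K i) ψ = (d * c) • χ) :
    BellFunctional.op ((1 / c) • B) (K i) ψ = d • χ := by
  have hc' : (c : ℂ) ≠ 0 := by exact_mod_cast hc.ne'
  rw [← opLin_apply, opLin_smul, smul_apply, opLin_apply, h, smul_smul]
  congr 1
  push_cast
  field_simp

variable {G i}

theorem eigen (hi : 0 < G.degree i) :
    (normalizedB G i 1).op (K i) (φp G) = φp G ∧
    (normalizedB G i 1).op (K i) (φm G) = -φm G ∧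
    (normalizedB G i 0).op (K i) (φp G) = φm G ∧
    (normalizedB G i 0).op (K i) (φm G) = φp G := by
  obtain ⟨h0, h1⟩ := normalized hi
  refine ⟨?_, ?_, ?_, ?_⟩
  · exact (op_one_div_smul i h1 (d := 1) (by rw [B_op_φp, one_mul])).trans (one_smul _ _)
  · exact (op_one_div_smul i h1 (d := -1) (by rw [B_op_φm, neg_one_mul])).trans (neg_one_smul _ _)
  · exact (op_one_div_smul i h0 (d := 1) (by rw [B'_op_φp, one_mul, β₀])).trans (one_smul _ _)
  · exact (op_one_div_smul i h0 (d := 1) (by rw [B'_op_φm, one_mul, β₀])).trans (one_smul _ _)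

theorem givesComplex (hi : 0 < G.degree i) :
    GivesComplex.{u} (normalizedB G i) (K i) (φp G) (φm G) ![σX, σZ] := by
  obtain ⟨h0, h1⟩ := normalized hi
  obtain ⟨e1, e2, e3, e4⟩ := eigen hi
  obtain ⟨hp, hm, horth⟩ := orthonormal G i
  refine givesComplex_of_intertwining ?_ (fun v x => (K_isReflection i v x).1)
    (fun v x => (K_isReflection i v x).2) ?_ ?_ hp hm horth ?_ <;> intro y <;> fin_cases y
  · exact BoundedBy.smul h0 (B'_boundedBy G i)
  · exact BoundedBy.smul h1 (B_boundedBy G i)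
  · exact σX_isSelfAdjoint
  · exact σZ_isSelfAdjoint
  · exact σX_mul_self
  · exact σZ_mul_self
  · refine comp_coisometryOf_adjoint (a := 0) (b := 1) (c := 1) (d := 0) (e3.trans ?_)
      (e4.trans ?_) (σX_ket_zero.trans ?_) (σX_ket_one.trans ?_) <;> module
  · refine comp_coisometryOf_adjoint (a := 1) (b := 0) (c := 0) (d := -1) (e1.trans ?_)
      (e2.trans ?_) (σZ_ket_zero.trans ?_) (σZ_ket_one.trans ?_) <;> module

end BASTA

theorem mainTheorem8 :
    -- CHSH / Tsirelson
    ((CHSH.B 1).op CHSH.K CHSH.φp = CHSH.φp ∧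
      (CHSH.B 1).op CHSH.K CHSH.φm = -CHSH.φm ∧
      (CHSH.B 0).op CHSH.K CHSH.φp = CHSH.φm ∧
      (CHSH.B 0).op CHSH.K CHSH.φm = CHSH.φp ∧
      GivesComplex.{u} CHSH.B CHSH.K CHSH.φp CHSH.φm ![σX, σZ]) ∧
    -- tilted CHSH
    (∀ θ : ℝ,
      (Tilted.B θ 1).op (Tilted.K θ) (Tilted.φp θ) = Tilted.φp θ ∧
      (Tilted.B θ 1).op (Tilted.K θ) (Tilted.φm θ) = -Tilted.φm θ ∧
      (Tilted.B θ 0).op (Tilted.K θ) (Tilted.φp θ) = Tilted.φm θ ∧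
      (Tilted.B θ 0).op (Tilted.K θ) (Tilted.φm θ) = Tilted.φp θ ∧
      GivesComplex.{u} (Tilted.B θ) (Tilted.K θ) (Tilted.φp θ) (Tilted.φm θ) ![σX, σZ]) ∧
    -- WBC
    (∀ θ φ ω : ℝ,
      Real.cos (θ + φ) * Real.cos φ * Real.cos (θ + ω) * Real.cos ω < 0 →
      (WBC.B θ φ ω 1).op (WBC.K θ φ ω) WBC.φp = WBC.φp ∧
      (WBC.B θ φ ω 1).op (WBC.K θ φ ω) WBC.φm = -WBC.φm ∧
      (WBC.B θ φ ω 0).op (WBC.K θ φ ω) WBC.φp =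
        -(Real.cos (θ + φ + ω) : ℂ) • WBC.φp
          + (Complex.I * (Real.sin (θ + φ + ω) : ℂ)) • WBC.φm ∧
      (WBC.B θ φ ω 0).op (WBC.K θ φ ω) WBC.φm =
        (Real.cos (θ + φ + ω) : ℂ) • WBC.φm
          - (Complex.I * (Real.sin (θ + φ + ω) : ℂ)) • WBC.φp ∧
      GivesComplex.{u} (WBC.B θ φ ω) (WBC.K θ φ ω) WBC.φp (-WBC.φm)
        ![-(Real.cos (θ + φ + ω) : ℂ) • σZ - (Real.sin (θ + φ + ω) : ℂ) • σY, σZ]) ∧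
    -- BASTA
    (∀ (V : Type) [Fintype V] [DecidableEq V] (G : SimpleGraph V) [DecidableRel G.Adj] (i : V),
      (∀ j, BASTA.stabilizer G j (BASTA.φp G) = BASTA.φp G ∧
        BASTA.stabilizer G j (BASTA.φm G) = -BASTA.φm G) ∧
      BellFunctional.BoundedBy.{u} (BASTA.β₁ G i) (BASTA.B G i) ∧
      (BASTA.B G i).op (BASTA.K i) (BASTA.φp G) = (BASTA.β₁ G i : ℂ) • BASTA.φp G ∧
      (BASTA.B G i).op (BASTA.K i) (BASTA.φm G) = -(BASTA.β₁ G i : ℂ) • BASTA.φm G ∧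
      BellFunctional.BoundedBy.{u} (2 * √2 * G.degree i) (BASTA.B' G i) ∧
      (BASTA.B' G i).op (BASTA.K i) (BASTA.φp G) =
        ((2 * √2 * G.degree i : ℝ) : ℂ) • BASTA.φm G ∧
      (BASTA.B' G i).op (BASTA.K i) (BASTA.φm G) =
        ((2 * √2 * G.degree i : ℝ) : ℂ) • BASTA.φp G ∧
      (0 < G.degree i →
        (BASTA.normalizedB G i 1).op (BASTA.K i) (BASTA.φp G) = BASTA.φp G ∧
        (BASTA.normalizedB G i 1).op (BASTA.K i) (BASTA.φm G) = -BASTA.φm G ∧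
        (BASTA.normalizedB G i 0).op (BASTA.K i) (BASTA.φp G) = BASTA.φm G ∧
        (BASTA.normalizedB G i 0).op (BASTA.K i) (BASTA.φm G) = BASTA.φp G ∧
        GivesComplex.{u} (BASTA.normalizedB G i) (BASTA.K i) (BASTA.φp G) (BASTA.φm G)
          ![σX, σZ])) := by
  obtain ⟨hB, hK, hp, hm⟩ := CHSH.eq_tilted
  refine ⟨?_, fun θ => ?_, fun θ φ ω h => ?_, fun V _ _ G _ i => ⟨fun j => ?_, ?_⟩⟩
  · rw [hB, hK, hp, hm]
    obtain ⟨h1, h2, h3, h4⟩ := Tilted.eigen (Real.pi / 4)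
    exact ⟨h1, h2, h3, h4, Tilted.givesComplex _⟩
  · obtain ⟨h1, h2, h3, h4⟩ := Tilted.eigen θ
    exact ⟨h1, h2, h3, h4, Tilted.givesComplex θ⟩
  · obtain ⟨h1, h2, h3, h4⟩ := WBC.eigen h
    exact ⟨h1, h2, h3, h4, WBC.givesComplex h⟩
  · exact ⟨BASTA.stabilizer_φp G j, BASTA.stabilizer_φm G j⟩
  · refine ⟨BASTA.B_boundedBy G i, BASTA.B_op_φp G i, BASTA.B_op_φm G i, BASTA.B'_boundedBy G i,
      BASTA.B'_op_φp G i, BASTA.B'_op_φm G i, fun hi => ?_⟩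
    obtain ⟨h1, h2, h3, h4⟩ := BASTA.eigen hi
    exact ⟨h1, h2, h3, h4, BASTA.givesComplex hi⟩
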